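/- Let $G$ be a countable discrete group. For a unitary representation $\pi$ of $G$ on a complex Hilbert space $\mathcal H$ and $f\in\mathbf C[G]$ put $\pi(f)=\sum_{s\in G}f(s)\pi(s)$; let $C^*_\pi(G)$ be the norm closure of $\{\pi(f): f\in\mathbf C[G]\}$ in $\mathcal B(\mathcal H)$ and $W^*_\pi(G)$ its closure in the strong operator topology. Irreducible representations are understood to be non-zero. One writes $\rho\prec\pi$ ($\rho$ is weakly contained in $\pi$) if $\|\rho(f)\|\le\|\pi(f)\|$ for all $f\in\mathbf C[G]$ (equivalently, for all elements of the maximal $C^*$-algebra $C^*(G)$), and $\rho\sim\pi$ (weak equivalence) if $\rho\prec\pi$ and $\pi\prec\rho$. A representation $\pi$ such that $W^*_\pi(G)$ is a factor is traceable if there are a faithful normal (not necessarily finite) trace $\tau$ on $W^*_\pi(G)$ and a positive $x\in C^*_\pi(G)$ with $0<\tau(x)<\infty$; for irreducible $\pi$ this means that $C^*_\pi(G)$ contains all compact operators on $\mathcal H$. For a subgroup $H\le G$ and a unitary representation $(\sigma,\mathcal K)$ of $H$, $\operatorname{Ind}_H^G\sigma$ is the representation of $G$ by left translations, $(g\cdot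 F)(x)=F(g^{-1}x)$, on the Hilbert space of maps $F:G\to\mathcal K$ with $F(xh)=\sigma(h^{-1})F(x)$ for $x\in G$, $h\in H$, and $\sum_{x\in G/H}\|F(x)\|^2<\infty$. A subgroup $L\le G$ is self-commensurating if it equals its commensurator $\{g\in G: gLg^{-1}\cap L\text{ has finite index in } L \text{ and in } gLg^{-1}\}$. For $g\in G$ and a representation $\sigma$ of $L$, $\sigma^g$ denotes the representation $x\mapsto\sigma(gxg^{-1})$ of $g^{-1}Lg$. Let $H\le G$ be a subgroup with the spectral gap property: the natural representation of $H$ on $\ell^2(X)$, where $X=(G/H)\setminus\{H\}$, does not weakly contain the trivial representation $1_H$. Then the following hold. (i) For every finite-dimensional irreducible unitary representation $\sigma$ of $H$, the representation $\operatorname{Ind}_H^G\sigma$ is irreducible and traceable, and its $C^*$-algebra $C^*_{\operatorname{Ind}_H^G\sigma}(G)$ contains all compact operators. (ii) Let $\sigma$ be a finite-dimensional irreducible unitary representation of $H$ and $\pi$ an irreducible unitary representation of $G$. If $\pi\sim\operatorname{Ind}_H^G\sigma$, then $\pi$ is unitarily equivalent to $\operatorname{Ind}_H^G\sigma$. (iii)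 Let $L\le G$ be a self-commensurating subgroup, and let $\sigma$ and $\pi$ be finite-dimensional irreducible unitary representations of $L$ and $H$, respectively. If $\operatorname{Ind}_L^G\sigma\sim\operatorname{Ind}_H^G\pi$, then there exists $g\in G$ such that $H=g^{-1}Lg$ and $\pi$ is unitarily equivalent to $\sigma^g$. -/

import Mathlib

open scoped ENNReal InnerProductSpace

universe u v w

noncomputable section

/-- A unitary representation of the discrete group `G` on the inner product space `E`
(a Hilbert space whenever `E` is complete). -/
abbrev UnitaryRep (G : Type u) [Group G] (E : Type v) [NormedAddCommGroup E]
    [InnerProductSpace ℂ E] : Type (max u v) :=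
  G →* (E ≃ₗᵢ[ℂ] E)

namespace UnitaryRep

section General

variable {G : Type u} [Group G]
variable {E : Type v} [NormedAddCommGroup E] [InnerProductSpace ℂ E]
variable {F : Type w} [NormedAddCommGroup F] [InnerProductSpace ℂ F]

/-- The operators `π(g)`, as a homomorphism into the algebra of bounded operators. -/
def toOperators (π : UnitaryRep G E) : G →* (E →L[ℂ] E) where
  toFun g := ((π g).toContinuousLinearEquiv : E →L[ℂ] E)
  map_one' := by
    ext x
    simp
  map_mul' a b := by
    ext x
    simp

@[simp]
theorem toOperators_apply (π : UnitaryRep G E) (g : G) (x : E) :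
    toOperators π g x = π g x := rfl

/-- The extension of `π` to the group algebra `ℂ[G]`: `π(f) = ∑ f(s) π(s)`. -/
def groupAlgebraHom (π : UnitaryRep G E) : MonoidAlgebra ℂ G →ₐ[ℂ] (E →L[ℂ] E) :=
  MonoidAlgebra.lift ℂ (E →L[ℂ] E) G (toOperators π)

/-- The C*-algebra `C*_π(G)`: the norm closure of `{π(f) | f ∈ ℂ[G]}` in `B(E)`. -/
def cstar (π : UnitaryRep G E) : Set (E →L[ℂ] E) :=
  closure (Set.range (groupAlgebraHom π))

/-- The von Neumann algebra `W*_π(G)`: the closure of `C*_π(G)` in `B(E)` for the strong operator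
topology, i.e. the topology of pointwise convergence (the topology induced from the product
topology on `E → E`). -/
def vonNeumann (π : UnitaryRep G E) : Set (E →L[ℂ] E) :=
  {T | (T : E → E) ∈ closure ((fun S : E →L[ℂ] E => (S : E → E)) '' cstar π)}

/-- Irreducibility: the space is non-zero, and the only closed invariant subspaces are the
trivial ones. -/
def IsIrreducible (π : UnitaryRep G E) : Prop :=
  Nontrivial E ∧ ∀ S : Submodule ℂ E, IsClosed (S : Set E) →
    (∀ g : G, ∀ x ∈ S, π g x ∈ S) → S = ⊥ ∨ S = ⊤

/-- Unitary equivalence. -/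
def UnitarilyEquivalent (π : UnitaryRep G E) (ρ : UnitaryRep G F) : Prop :=
  ∃ U : E ≃ₗᵢ[ℂ] F, ∀ (g : G) (x : E), U (π g x) = ρ g (U x)

/-- `ρ ≺ π`: `‖ρ(x)‖ ≤ ‖π(x)‖` for all `x` in `ℂ[G]`; since `ℂ[G]` is dense in the
maximal C*-algebra `C*(G)`, this is the same as the inequality for all `x` in `C*(G)`. -/
def WeaklyContained (ρ : UnitaryRep G F) (π : UnitaryRep G E) : Prop :=
  ∀ x : MonoidAlgebra ℂ G, ‖groupAlgebraHom ρ x‖ ≤ ‖groupAlgebraHom π x‖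

/-- Weak equivalence `ρ ∼ π`. -/
def WeaklyEquivalent (ρ : UnitaryRep G F) (π : UnitaryRep G E) : Prop :=
  WeaklyContained ρ π ∧ WeaklyContained π ρ

/-- The trivial representation `1_G` on `ℂ`. -/
def trivial (G : Type u) [Group G] : UnitaryRep G ℂ := 1

/-- `C*_π(G)` contains all compact operators. -/
def ContainsCompacts (π : UnitaryRep G E) : Prop :=
  ∀ T : E →L[ℂ] E, IsCompactOperator T → T ∈ cstar π

/-- `π` is factorial: the centre of the von Neumann algebra `W*_π(G)` consists of the scalar
operators (and the space is non-zero). -/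
def IsFactorial (π : UnitaryRep G E) : Prop :=
  Nontrivial E ∧ ∀ T ∈ vonNeumann π, (∀ S ∈ vonNeumann π, T * S = S * T) →
    ∃ c : ℂ, T = c • (1 : E →L[ℂ] E)

end General

section Trace

variable {E : Type v} [NormedAddCommGroup E] [InnerProductSpace ℂ E] [CompleteSpace E]

/-- `τ` restricts to a faithful normal (not necessarily finite) trace on the positive cone of the
von Neumann algebra `W ⊆ B(E)`; the values of `τ` elsewhere are irrelevant. -/
structure IsFaithfulNormalTrace (W : Set (E →L[ℂ] E)) (τ : (E →L[ℂ] E) → ℝ≥0∞) : Prop where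
  map_add : ∀ x ∈ W, ∀ y ∈ W, 0 ≤ x → 0 ≤ y → τ (x + y) = τ x + τ y
  map_smul : ∀ x ∈ W, 0 ≤ x → ∀ c : NNReal, τ (((c : ℝ) : ℂ) • x) = (c : ℝ≥0∞) * τ x
  tracial : ∀ x ∈ W, τ (star x * x) = τ (x * star x)
  faithful : ∀ x ∈ W, 0 ≤ x → τ x = 0 → x = 0
  normal : ∀ D ⊆ W, D.Nonempty → (∀ d ∈ D, 0 ≤ d) → DirectedOn (· ≤ ·) D →
    ∀ x ∈ W, IsLUB D x → τ x = ⨆ d ∈ D, τ d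

/-- A factorial representation `π` is traceable (or normal) if there are a faithful normal trace
`τ` on `W*_π(G)` and a positive `x ∈ C*_π(G)` with `0 < τ(x) < ∞`. -/
def IsTraceable {G : Type u} [Group G] (π : UnitaryRep G E) : Prop :=
  IsFactorial π ∧ ∃ τ : (E →L[ℂ] E) → ℝ≥0∞, IsFaithfulNormalTrace (vonNeumann π) τ ∧
    ∃ x ∈ cstar π, 0 ≤ x ∧ 0 < τ x ∧ τ x < ∞

end Trace

section Permutation

variable (G : Type u) [Group G] (X : Type v) [MulAction G X]

theorem memℓp_translate (g : G) {f : X → ℂ} (hf : Memℓp f 2) :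
    Memℓp (fun x => f (g⁻¹ • x)) 2 := by
  rw [memℓp_gen_iff (by norm_num)] at hf ⊢
  exact hf.comp_injective (MulAction.injective g⁻¹)

/-- Translation by `g` on `ℓ²(X)`, as a linear map. -/
def translate (g : G) : lp (fun _ : X => ℂ) 2 →ₗ[ℂ] lp (fun _ : X => ℂ) 2 where
  toFun f := ⟨fun x => f (g⁻¹ • x), memℓp_translate G X g (lp.memℓp f)⟩
  map_add' _ _ := rfl
  map_smul' _ _ := rfl

@[simp]
theorem translate_apply (g : G) (f : lp (fun _ : X => ℂ) 2) (x : X) :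
    translate G X g f x = f (g⁻¹ • x) := rfl

theorem norm_translate (g : G) (f : lp (fun _ : X => ℂ) 2) : ‖translate G X g f‖ = ‖f‖ := by
  have h : (0 : ℝ) < (2 : ℝ≥0∞).toReal := by norm_num
  rw [lp.norm_eq_tsum_rpow h, lp.norm_eq_tsum_rpow h]
  congr 1
  exact (MulAction.toPerm g⁻¹).tsum_eq (fun x => ‖f x‖ ^ (2 : ℝ≥0∞).toReal)

/-- The natural representation `π_X` of `G` on `ℓ²(X)`: `(π_X(g) f)(x) = f(g⁻¹ x)`. -/
def permutation : UnitaryRep G (lp (fun _ : X => ℂ) 2) where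
  toFun g :=
    { toLinearEquiv := LinearEquiv.ofLinearMap (translate G X g) (translate G X g⁻¹)
        (by ext f x; simp) (by ext f x; simp)
      norm_map' := norm_translate G X g }
  map_one' := by
    ext f x
    change f ((1 : G)⁻¹ • x) = f x
    simp
  map_mul' a b := by
    ext f x
    change f ((a * b)⁻¹ • x) = f (b⁻¹ • a⁻¹ • x)
    rw [mul_inv_rev, mul_smul]

@[simp]
theorem permutation_apply (g : G) (f : lp (fun _ : X => ℂ) 2) (x : X) :
    permutation G X g f x = f (g⁻¹ • x) := rfl

/-- The action of `G` on `X` has a spectral gap: `π_X` does not weakly contain `1_G`. -/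
def HasSpectralGap : Prop := ¬ WeaklyContained (trivial G) (permutation G X)

end Permutation

section Subgroups

variable {G : Type u} [Group G]

/-- `G/H ∖ {H}` with the natural action of `H`. -/
def cosetsAwayFromBase (H : Subgroup G) : SubMulAction H (G ⧸ H) where
  carrier := {q | q ≠ ((1 : G) : G ⧸ H)}
  smul_mem' h q hq := by
    intro hh
    apply hq
    have : q = h⁻¹ • ((1 : G) : G ⧸ H) := by rw [← hh, inv_smul_smul]
    rw [this]
    change (((h⁻¹ : H) : G) * 1 : G) = ((1 : G) : G ⧸ H)
    rw [QuotientGroup.eq]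
    simp

/-- `H` has the spectral gap property: the action of `H` on `G/H ∖ {H}` has a spectral gap. -/
def HasSpectralGapProperty (H : Subgroup G) : Prop :=
  HasSpectralGap H (cosetsAwayFromBase H)

/-- `H` is self-commensurating: `Comm_G(H) = H`. -/
def IsSelfCommensurating (H : Subgroup G) : Prop :=
  Subgroup.Commensurable.commensurator H = H

/-- The conjugate `g⁻¹ L g = {x | g x g⁻¹ ∈ L}`. -/
def conjSubgroup (L : Subgroup G) (g : G) : Subgroup G :=
  L.comap (MulAut.conj g).toMonoidHom

/-- The representation `σ^g` of `g⁻¹ L g`: `σ^g(x) = σ(g x g⁻¹)`. -/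
def conjRep {E : Type v} [NormedAddCommGroup E] [InnerProductSpace ℂ E]
    {L : Subgroup G} (σ : UnitaryRep L E) (g : G) : UnitaryRep (conjSubgroup L g) E :=
  σ.comp ((MulAut.conj g).toMonoidHom.subgroupComap L)

end Subgroups

section Induced

variable {G : Type u} [Group G] {H : Subgroup G}
variable {K : Type v} [NormedAddCommGroup K] [InnerProductSpace ℂ K]

/-- The maps `f : G → K` with `f(xh) = σ(h⁻¹) f(x)` for `x ∈ G`, `h ∈ H`, and
`∑_{x ∈ G/H} ‖f(x)‖² < ∞` (the norm of `f(x)` depends only on the coset `xH`). -/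
def inducedSubmodule (σ : UnitaryRep H K) : Submodule ℂ (G → K) where
  carrier := {f | (∀ (x : G) (h : H), f (x * h) = σ h⁻¹ (f x)) ∧
    Summable fun q : G ⧸ H => ‖f q.out‖ ^ 2}
  zero_mem' := by
    refine ⟨fun x h => by simp, ?_⟩
    simp
  add_mem' := by
    rintro a b ⟨ha, ha'⟩ ⟨hb, hb'⟩
    refine ⟨fun x h => by simp [ha, hb], ?_⟩
    refine Summable.of_nonneg_of_le (fun _ => by positivity) (fun q => ?_)
      ((ha'.add hb').mul_left 2)
    have h1 := norm_add_le (a q.out) (b q.out)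
    have h2 := norm_nonneg (a q.out + b q.out)
    simp only [Pi.add_apply]
    nlinarith [sq_nonneg (‖a q.out‖ - ‖b q.out‖)]
  smul_mem' := by
    rintro c a ⟨ha, ha'⟩
    refine ⟨fun x h => by simp [ha], ?_⟩
    simpa [norm_smul, mul_pow] using ha'.mul_left (‖c‖ ^ 2)

/-- The space of the induced representation (a type of its own, so that it carries the `ℓ²`
topology and not that of pointwise convergence). -/
def InducedSpace (σ : UnitaryRep H K) : Type (max u v) := inducedSubmodule σ

namespace InducedSpace

variable {σ : UnitaryRep H K}

instance : AddCommGroup (InducedSpace σ) := inferInstanceAs (AddCommGroup (inducedSubmodule σ))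

instance : Module ℂ (InducedSpace σ) := inferInstanceAs (Module ℂ (inducedSubmodule σ))

/-- The underlying map `G → K`. -/
def toFun (f : InducedSpace σ) : G → K := Subtype.val (p := (· ∈ inducedSubmodule σ)) f

instance : CoeFun (InducedSpace σ) (fun _ => G → K) := ⟨toFun⟩

/-- An element of the space of the induced representation from its defining properties. -/
def mk (f : G → K) (h₁ : ∀ (x : G) (h : H), f (x * h) = σ h⁻¹ (f x))
    (h₂ : Summable fun q : G ⧸ H => ‖f q.out‖ ^ 2) : InducedSpace σ :=
  (⟨f, h₁, h₂⟩ : inducedSubmodule σ)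

@[simp]
theorem mk_apply (f : G → K) (h₁ : ∀ (x : G) (h : H), f (x * h) = σ h⁻¹ (f x))
    (h₂ : Summable fun q : G ⧸ H => ‖f q.out‖ ^ 2) (x : G) : mk f h₁ h₂ x = f x := rfl

@[ext]
theorem ext {f f' : InducedSpace σ} (h : ∀ x, f x = f' x) : f = f' := Subtype.ext (funext h)

@[simp]
theorem add_apply (f f' : InducedSpace σ) (x : G) : (f + f') x = f x + f' x := rfl

@[simp]
theorem smul_apply (c : ℂ) (f : InducedSpace σ) (x : G) : (c • f) x = c • f x := rfl

@[simp]
theorem zero_apply (x : G) : (0 : InducedSpace σ) x = 0 := rfl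

theorem apply_mul (f : InducedSpace σ) (x : G) (h : H) : f (x * h) = σ h⁻¹ (f x) :=
  (Subtype.property (p := (· ∈ inducedSubmodule σ)) f).1 x h

theorem summable_norm_sq (f : InducedSpace σ) : Summable fun q : G ⧸ H => ‖f q.out‖ ^ 2 :=
  (Subtype.property (p := (· ∈ inducedSubmodule σ)) f).2

theorem norm_apply_eq (f : InducedSpace σ) {x y : G} (hxy : (x : G ⧸ H) = y) : ‖f x‖ = ‖f y‖ := by
  rw [QuotientGroup.eq] at hxy
  have h := f.apply_mul x ⟨_, hxy⟩
  simp only [mul_inv_cancel_left] at h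
  rw [h, LinearIsometryEquiv.norm_map]

/-- Restriction to a system of representatives of `G/H`. -/
def toLp (f : InducedSpace σ) : lp (fun _ : G ⧸ H => K) 2 :=
  ⟨fun q => f q.out, (memℓp_gen_iff (by norm_num)).mpr (by simpa using f.summable_norm_sq)⟩

@[simp]
theorem toLp_apply (f : InducedSpace σ) (q : G ⧸ H) : toLp f q = f q.out := rfl

theorem toLp_add (f f' : InducedSpace σ) : toLp (f + f') = toLp f + toLp f' := rfl

theorem toLp_smul (c : ℂ) (f : InducedSpace σ) : toLp (c • f) = c • toLp f := rfl

theorem eq_of_out (f : InducedSpace σ) (x : G) :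
    f x = σ ⟨x⁻¹ * (x : G ⧸ H).out, QuotientGroup.eq.mp (by simp)⟩ (f (x : G ⧸ H).out) := by
  have h := f.apply_mul x ⟨x⁻¹ * (x : G ⧸ H).out, QuotientGroup.eq.mp (by simp)⟩
  simp only [mul_inv_cancel_left] at h
  rw [h, map_inv]
  exact ((σ _).apply_symm_apply _).symm

theorem toLp_injective : Function.Injective (toLp : InducedSpace σ → _) := by
  intro f f' h
  ext x
  have h' : f (x : G ⧸ H).out = f' (x : G ⧸ H).out :=
    congrArg (fun k : lp (fun _ : G ⧸ H => K) 2 => k (x : G ⧸ H)) h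
  rw [f.eq_of_out, f'.eq_of_out, h']

/-- The inner product `⟪f, f'⟫ = ∑_{x ∈ G/H} ⟪f(x), f'(x)⟫`. -/
@[reducible]
def core : InnerProductSpace.Core ℂ (InducedSpace σ) where
  inner f f' := ∑' q : G ⧸ H, ⟪f q.out, f' q.out⟫_ℂ
  conj_inner_symm f f' := by
    have h := inner_conj_symm (𝕜 := ℂ) (toLp f) (toLp f')
    rwa [lp.inner_eq_tsum, lp.inner_eq_tsum] at h
  re_inner_nonneg f := by
    have h := inner_self_nonneg (𝕜 := ℂ) (x := toLp f)
    rwa [lp.inner_eq_tsum] at h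
  add_left f f' f'' := by
    have h := inner_add_left (𝕜 := ℂ) (toLp f) (toLp f') (toLp f'')
    rwa [lp.inner_eq_tsum, lp.inner_eq_tsum, lp.inner_eq_tsum] at h
  smul_left f f' c := by
    have h := inner_smul_left (𝕜 := ℂ) (toLp f) (toLp f') c
    rwa [lp.inner_eq_tsum, lp.inner_eq_tsum] at h
  definite f hf := by
    have h : ⟪toLp f, toLp f⟫_ℂ = 0 := by rwa [lp.inner_eq_tsum]
    exact toLp_injective (inner_self_eq_zero.mp h)

instance : NormedAddCommGroup (InducedSpace σ) := core.toNormedAddCommGroup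

instance : InnerProductSpace ℂ (InducedSpace σ) := InnerProductSpace.ofCore core.toCore

theorem inner_def (f f' : InducedSpace σ) :
    ⟪f, f'⟫_ℂ = ∑' q : G ⧸ H, ⟪f q.out, f' q.out⟫_ℂ := rfl

theorem inner_toLp (f f' : InducedSpace σ) : ⟪toLp f, toLp f'⟫_ℂ = ⟪f, f'⟫_ℂ := by
  rw [lp.inner_eq_tsum, inner_def]
  rfl

theorem norm_toLp (f : InducedSpace σ) : ‖toLp f‖ = ‖f‖ := by
  rw [@norm_eq_sqrt_re_inner ℂ, @norm_eq_sqrt_re_inner ℂ, inner_toLp]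

theorem norm_sq_eq (f : InducedSpace σ) : ‖f‖ ^ 2 = ∑' q : G ⧸ H, ‖f q.out‖ ^ 2 := by
  have h := lp.norm_rpow_eq_tsum (p := 2) (by norm_num) (toLp f)
  rw [norm_toLp] at h
  simpa using h

/-- The extension of an `ℓ²` map on representatives to an equivariant map on `G`. -/
def ofLp (σ : UnitaryRep H K) (f : lp (fun _ : G ⧸ H => K) 2) : InducedSpace σ :=
  mk (fun x => σ ⟨x⁻¹ * (x : G ⧸ H).out, QuotientGroup.eq.mp (by simp)⟩ (f (x : G ⧸ H)))
    (by
      intro x h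
      have hq : ((x * h : G) : G ⧸ H) = x := by simp
      have : ∀ (q : G ⧸ H) (hq : q = (x : G ⧸ H)) (hm : (x * (h : G))⁻¹ * q.out ∈ H),
          σ ⟨(x * (h : G))⁻¹ * q.out, hm⟩ (f q) =
            σ h⁻¹ (σ ⟨x⁻¹ * (x : G ⧸ H).out, QuotientGroup.eq.mp (by simp)⟩ (f (x : G ⧸ H))) := by
        rintro q rfl hm
        rw [← Function.comp_apply (f := σ h⁻¹), ← LinearIsometryEquiv.coe_mul, ← map_mul]
        congr 2
        ext
        simp [mul_assoc]
      exact this _ hq _)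
    (by
      have h := lp.memℓp f
      rw [memℓp_gen_iff (by norm_num)] at h
      simpa using h)

theorem toLp_ofLp (f : lp (fun _ : G ⧸ H => K) 2) : toLp (ofLp σ f) = f := by
  ext q
  change σ ⟨q.out⁻¹ * ((q.out : G) : G ⧸ H).out, _⟩ (f ((q.out : G) : G ⧸ H)) = f q
  have : ∀ (r : G ⧸ H) (hr : r = q) (hm : q.out⁻¹ * r.out ∈ H),
      σ ⟨q.out⁻¹ * r.out, hm⟩ (f r) = f q := by
    rintro r rfl hm
    have : (⟨r.out⁻¹ * r.out, hm⟩ : H) = 1 := by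
      ext
      simp
    rw [this, map_one]
    rfl
  exact this _ (by simp) _

/-- Restriction to representatives is an isometry onto `ℓ²(G/H, K)`. -/
def toLpEquiv (σ : UnitaryRep H K) : InducedSpace σ ≃ₗᵢ[ℂ] lp (fun _ : G ⧸ H => K) 2 where
  toFun := toLp
  invFun := ofLp σ
  map_add' := toLp_add
  map_smul' := toLp_smul
  left_inv _ := toLp_injective (toLp_ofLp _)
  right_inv := toLp_ofLp
  norm_map' := norm_toLp

instance [CompleteSpace K] : CompleteSpace (InducedSpace σ) :=
  (toLpEquiv σ).toIsometryEquiv.completeSpace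

theorem norm_out_smul (f : InducedSpace σ) (g : G) (q : G ⧸ H) :
    ‖f (g * q.out)‖ = ‖f (g • q).out‖ := by
  apply norm_apply_eq
  rw [QuotientGroup.out_eq', ← smul_eq_mul, MulAction.Quotient.coe_smul_out]

/-- Left translation `(π(g) f)(x) = f(g⁻¹ x)`, as a linear map. -/
def leftTranslate (σ : UnitaryRep H K) (g : G) : InducedSpace σ →ₗ[ℂ] InducedSpace σ where
  toFun f := mk (fun x => f (g⁻¹ * x))
    (fun x h => by simp only [← mul_assoc, f.apply_mul])
    (by
      simp only [norm_out_smul]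
      exact f.summable_norm_sq.comp_injective (MulAction.injective g⁻¹))
  map_add' _ _ := rfl
  map_smul' _ _ := rfl

@[simp]
theorem leftTranslate_apply (g : G) (f : InducedSpace σ) (x : G) :
    leftTranslate σ g f x = f (g⁻¹ * x) := rfl

theorem norm_leftTranslate (g : G) (f : InducedSpace σ) : ‖leftTranslate σ g f‖ = ‖f‖ := by
  rw [← sq_eq_sq₀ (norm_nonneg _) (norm_nonneg _), norm_sq_eq, norm_sq_eq]
  simp only [leftTranslate_apply, norm_out_smul]
  exact (MulAction.toPerm (g⁻¹ : G)).tsum_eq (fun q : G ⧸ H => ‖f q.out‖ ^ 2)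

end InducedSpace

/-- The induced representation `Ind_H^G σ`: `(π(g) f)(x) = f(g⁻¹ x)`. -/
def induced (σ : UnitaryRep H K) : UnitaryRep G (InducedSpace σ) where
  toFun g :=
    { toLinearEquiv := LinearEquiv.ofLinearMap (InducedSpace.leftTranslate σ g) (InducedSpace.leftTranslate σ g⁻¹)
        (by ext f x; simp) (by ext f x; simp)
      norm_map' := InducedSpace.norm_leftTranslate g }
  map_one' := by
    ext f x
    change f ((1 : G)⁻¹ * x) = f x
    simp
  map_mul' a b := by
    ext f x
    change f ((a * b)⁻¹ * x) = f (b⁻¹ * (a⁻¹ * x))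
    rw [mul_inv_rev, mul_assoc]

@[simp]
theorem induced_apply (σ : UnitaryRep H K) (g : G) (f : InducedSpace σ) (x : G) :
    induced σ g f x = f (g⁻¹ * x) := rfl

end Induced

end UnitaryRep

end

noncomputable section

namespace UnitaryRep

/-!
A family `T : M → Ind σ` of vectors supported off `H`, with `M` finite dimensional, has slice norms
`‖T(·)(x)‖` that form a vector of `ℓ²((G/H) ∖ {H})` and do not change when `T` is twisted by a
unitary of `M`. The spectral gap therefore bounds `T` by finitely many differences
`s ∘ T - T ∘ τ(s)`, for any representation `τ` of `H` on `M`. For `τ = σ`, Burnside's theorem turns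
these differences into elements of `ℂ[H]` killed by `σ`, which gives a positive `D ∈ ℂ[H]` with
`σ(D) = 0` and `Ind σ(D)` bounded below on the functions vanishing on `H`. Powers of `1 - tD` then
converge in norm to the projection onto the functions supported on `H`; multiplying it by `ℂ[H]` and
by translations yields all rank-one operators, hence (i).

A weak equivalence is an isomorphism `a ↦ a'` of `C*`-algebras. If `e` is a unit vector and
`p ∈ C*_{Ind σ}(G)` is the projection onto its span, then `p'` is a nonzero projection, and
`a e ↦ a' y`, with `y` a unit vector in the range of `p'`, is an isometric intertwiner. This gives
(ii). In (iii) it embeds `Ind π` into `Ind σ`; the image of the functions supported on `H` has slice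
norms that are square summable and constant on `H`-orbits in `G/L`, so a coset where they do not
vanish has a finite orbit, and a conjugate of `L` contains a subgroup of finite index of `H`. The
adjoint gives the converse, and both groups are self-commensurating, so they are conjugate; Schur's
lemma finishes the proof.
-/

open Filter Topology

section GroupAlgebra

variable {G : Type u} [Group G]
variable {E : Type v} [NormedAddCommGroup E] [InnerProductSpace ℂ E]
variable {F : Type w} [NormedAddCommGroup F] [InnerProductSpace ℂ F]

@[simp]
theorem groupAlgebraHom_single (π : UnitaryRep G E) (g : G) (c : ℂ) :
    groupAlgebraHom π (MonoidAlgebra.single g c) = c • toOperators π g :=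
  MonoidAlgebra.lift_single _ _ _

theorem inner_rep_left (π : UnitaryRep G E) (g : G) (x y : E) :
    ⟪π g x, y⟫_ℂ = ⟪x, π g⁻¹ y⟫_ℂ := by
  rw [map_inv]
  exact LinearIsometryEquiv.inner_map_eq_flip _ _ _

theorem star_toOperators [CompleteSpace E] (π : UnitaryRep G E) (g : G) :
    star (toOperators π g) = toOperators π g⁻¹ := by
  rw [ContinuousLinearMap.star_eq_adjoint, eq_comm, ContinuousLinearMap.eq_adjoint_iff]
  intro x y
  rw [toOperators_apply, toOperators_apply, inner_rep_left, inv_inv]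

/-- `b` is the image of `a` under the involution of `ℂ[G]`, hence the same for both
representations. -/
theorem exists_groupAlgebraHom_eq_star [CompleteSpace E] [CompleteSpace F]
    (π : UnitaryRep G E) (ρ : UnitaryRep G F) (a : MonoidAlgebra ℂ G) :
    ∃ b, groupAlgebraHom π b = star (groupAlgebraHom π a) ∧
      groupAlgebraHom ρ b = star (groupAlgebraHom ρ a) := by
  induction a using MonoidAlgebra.induction_linear with
  | zero => exact ⟨0, by simp, by simp⟩
  | add a a' ha ha' =>
    obtain ⟨b, hb, hb'⟩ := ha
    obtain ⟨c, hc, hc'⟩ := ha'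
    exact ⟨b + c, by simp [hb, hc], by simp [hb', hc']⟩
  | single g c =>
    exact ⟨MonoidAlgebra.single g⁻¹ (star c), by simp [star_toOperators],
      by simp [star_toOperators]⟩

theorem groupAlgebraHom_apply_mem {π : UnitaryRep G E} {S : Submodule ℂ E}
    (hS : ∀ g, ∀ x ∈ S, π g x ∈ S) (a : MonoidAlgebra ℂ G) {x : E} (hx : x ∈ S) :
    groupAlgebraHom π a x ∈ S := by
  induction a using MonoidAlgebra.induction_linear with
  | zero => simp
  | add a b ha hb => simpa using S.add_mem ha hb
  | single g c => simpa using S.smul_mem _ (hS g x hx)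

theorem groupAlgebraHom_comp {G' : Type w} [Group G'] (π : UnitaryRep G E) (φ : G' →* G)
    (a : MonoidAlgebra ℂ G') :
    groupAlgebraHom (π.comp φ : UnitaryRep G' E) a =
      groupAlgebraHom π (MonoidAlgebra.mapDomain φ a) := by
  induction a using MonoidAlgebra.induction_linear with
  | zero => simp
  | add a b ha hb => rw [map_add, ha, hb, MonoidAlgebra.mapDomain_add, map_add]
  | single g c =>
    rw [MonoidAlgebra.mapDomain_single, groupAlgebraHom_single, groupAlgebraHom_single]
    rfl

/-- `T` is an intertwining operator from `π` to `ρ`. -/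
def Intertwines (π : UnitaryRep G E) (ρ : UnitaryRep G F) (T : E →L[ℂ] F) : Prop :=
  ∀ g x, T (π g x) = ρ g (T x)

theorem Intertwines.groupAlgebraHom_apply {π : UnitaryRep G E} {ρ : UnitaryRep G F}
    {T : E →L[ℂ] F} (hT : Intertwines π ρ T) (a : MonoidAlgebra ℂ G) (x : E) :
    T (groupAlgebraHom π a x) = groupAlgebraHom ρ a (T x) := by
  induction a using MonoidAlgebra.induction_linear generalizing x with
  | zero => simp
  | add a b ha hb => simp [ha, hb]
  | single g c => simp [hT g x]

theorem Intertwines.adjoint [CompleteSpace E] [CompleteSpace F] {π : UnitaryRep G E}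
    {ρ : UnitaryRep G F} {T : E →L[ℂ] F} (hT : Intertwines π ρ T) :
    Intertwines ρ π T.adjoint := by
  intro g y
  refine ext_inner_right ℂ fun x => ?_
  rw [ContinuousLinearMap.adjoint_inner_left, inner_rep_left, inner_rep_left,
    ContinuousLinearMap.adjoint_inner_left, hT]

variable [CompleteSpace E]

/-- The algebra `{π(f) | f ∈ ℂ[G]}`, which is closed under taking adjoints. -/
def groupAlgebraRange (π : UnitaryRep G E) : StarSubalgebra ℂ (E →L[ℂ] E) where
  toSubalgebra := (groupAlgebraHom π).range
  star_mem' := by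
    rintro _ ⟨a, rfl⟩
    exact (exists_groupAlgebraHom_eq_star π π a).imp fun _ h => h.1

/-- `C*_π(G)` as a star subalgebra of `B(E)`; its underlying set is `cstar π`. -/
def cstarAlgebra (π : UnitaryRep G E) : StarSubalgebra ℂ (E →L[ℂ] E) :=
  (groupAlgebraRange π).topologicalClosure

theorem coe_cstarAlgebra (π : UnitaryRep G E) :
    (cstarAlgebra π : Set (E →L[ℂ] E)) = cstar π := by
  rw [cstarAlgebra, StarSubalgebra.topologicalClosure_coe]
  rfl

theorem mem_cstarAlgebra {π : UnitaryRep G E} {T : E →L[ℂ] E} :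
    T ∈ cstarAlgebra π ↔ T ∈ cstar π := by
  rw [← SetLike.mem_coe, coe_cstarAlgebra]

theorem isClosed_cstarAlgebra (π : UnitaryRep G E) :
    IsClosed (cstarAlgebra π : Set (E →L[ℂ] E)) :=
  (groupAlgebraRange π).isClosed_topologicalClosure

theorem groupAlgebraHom_mem_cstarAlgebra (π : UnitaryRep G E) (a : MonoidAlgebra ℂ G) :
    groupAlgebraHom π a ∈ cstarAlgebra π :=
  (groupAlgebraRange π).le_topologicalClosure ⟨a, rfl⟩

theorem toOperators_mem_cstarAlgebra (π : UnitaryRep G E) (g : G) :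
    toOperators π g ∈ cstarAlgebra π := by
  simpa using groupAlgebraHom_mem_cstarAlgebra π (MonoidAlgebra.single g 1)

theorem apply_mem_of_mem_cstarAlgebra {π : UnitaryRep G E} {S : Submodule ℂ E}
    (hSc : IsClosed (S : Set E)) (hS : ∀ g, ∀ x ∈ S, π g x ∈ S) {T : E →L[ℂ] E}
    (hT : T ∈ cstarAlgebra π) {x : E} (hx : x ∈ S) : T x ∈ S := by
  have hsub : cstar π ⊆ {T : E →L[ℂ] E | T x ∈ S} := by
    refine closure_minimal ?_ (hSc.preimage (ContinuousLinearMap.apply ℂ E x).continuous)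
    rintro _ ⟨a, rfl⟩
    exact groupAlgebraHom_apply_mem hS a hx
  exact hsub (mem_cstarAlgebra.mp hT)

end GroupAlgebra

section FiniteDimensional

variable {G : Type u} [Group G]
variable {E : Type v} [NormedAddCommGroup E] [InnerProductSpace ℂ E] [FiniteDimensional ℂ E]

theorem IsIrreducible.exists_groupAlgebraHom_apply_eq {π : UnitaryRep G E} (hπ : π.IsIrreducible)
    {v : E} (hv : v ≠ 0) (u : E) : ∃ a, groupAlgebraHom π a v = u := by
  let orbitSpan : Submodule ℂ E := LinearMap.range
    ((ContinuousLinearMap.apply ℂ E v : (E →L[ℂ] E) →ₗ[ℂ] E) ∘ₗ (groupAlgebraHom π).toLinearMap)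
  have hinv : ∀ g, ∀ x ∈ orbitSpan, π g x ∈ orbitSpan := by
    rintro g _ ⟨a, rfl⟩
    exact ⟨MonoidAlgebra.single g 1 * a, by simp⟩
  have hv_mem : v ∈ orbitSpan := ⟨1, by simp⟩
  rcases hπ.2 orbitSpan orbitSpan.closed_of_finiteDimensional hinv with h | h
  · exact absurd ((Submodule.mem_bot ℂ).mp (h ▸ hv_mem)) hv
  · exact (h ▸ Submodule.mem_top : u ∈ orbitSpan)

theorem IsIrreducible.exists_eq_smul_of_commute {π : UnitaryRep G E} (hπ : π.IsIrreducible)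
    (T : E →ₗ[ℂ] E) (hT : ∀ g x, T (π g x) = π g (T x)) : ∃ c : ℂ, ∀ x, T x = c • x := by
  have := hπ.1
  obtain ⟨c, hc⟩ := Module.End.exists_eigenvalue T
  have hinv : ∀ g, ∀ x ∈ Module.End.eigenspace T c, π g x ∈ Module.End.eigenspace T c := by
    intro g x hx
    rw [Module.End.mem_eigenspace_iff] at hx ⊢
    rw [hT, hx, map_smul]
  rcases hπ.2 _ (Module.End.eigenspace T c).closed_of_finiteDimensional hinv with h | h
  · exact absurd h hc
  · exact ⟨c, fun x => Module.End.mem_eigenspace_iff.mp (h ▸ Submodule.mem_top)⟩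

/-- Burnside's theorem, from Schur's lemma and the Jacobson density theorem. -/
theorem IsIrreducible.groupAlgebraHom_surjective {π : UnitaryRep G E} (hπ : π.IsIrreducible) :
    Function.Surjective (groupAlgebraHom π) := by
  classical
  intro B
  let : Module (MonoidAlgebra ℂ G) E :=
    Module.compHom E (groupAlgebraHom π : MonoidAlgebra ℂ G →+* (E →L[ℂ] E))
  have hsmul (a : MonoidAlgebra ℂ G) (x : E) : a • x = groupAlgebraHom π a x := rfl
  have hscalar (c : ℂ) (x : E) : c • x = (MonoidAlgebra.single 1 c : MonoidAlgebra ℂ G) • x := by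
    simp [hsmul]
  have : IsSimpleModule (MonoidAlgebra ℂ G) E :=
    isSimpleModule_iff_toSpanSingleton_surjective.mpr
      ⟨hπ.1, fun _ hv u => hπ.exists_groupAlgebraHom_apply_eq hv u⟩
  have hschur (T : Module.End (MonoidAlgebra ℂ G) E) : ∃ c : ℂ, ∀ x, T x = c • x := by
    refine hπ.exists_eq_smul_of_commute
      { toFun := T, map_add' := map_add T, map_smul' := fun c x => ?_ } fun g x => ?_
    · rw [hscalar, map_smul, RingHom.id_apply, hscalar]
    · simpa [hsmul] using T.map_smul (MonoidAlgebra.single g 1) x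
  let B' : Module.End (Module.End (MonoidAlgebra ℂ G) E) E :=
    { toFun := B
      map_add' := map_add B
      map_smul' := fun T x => by
        obtain ⟨c, hc⟩ := hschur T
        change B (T x) = T (B x)
        rw [hc, hc, map_smul] }
  let b := Module.finBasis ℂ E
  obtain ⟨a, ha⟩ := jacobson_density B' (Finset.univ.image b)
  refine ⟨a, ContinuousLinearMap.coe_injective (b.ext fun i => ?_)⟩
  exact (ha (b i) (by simp)).symm

end FiniteDimensional

namespace InducedSpace

variable {G : Type u} [Group G] {H : Subgroup G}
variable {K : Type v} [NormedAddCommGroup K] [InnerProductSpace ℂ K] {σ : UnitaryRep H K}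

@[simp]
theorem sub_apply (f f' : InducedSpace σ) (x : G) : (f - f') x = f x - f' x := rfl

theorem norm_apply_le (f : InducedSpace σ) (x : G) : ‖f x‖ ≤ ‖f‖ := by
  refine le_of_sq_le_sq ?_ (norm_nonneg _)
  rw [norm_sq_eq, norm_apply_eq f (y := (x : G ⧸ H).out) (by simp)]
  exact f.summable_norm_sq.le_tsum (x : G ⧸ H) fun _ _ => by positivity

theorem apply_of_mem (f : InducedSpace σ) {x : G} (hx : x ∈ H) : f x = σ ⟨x, hx⟩⁻¹ (f 1) := by
  simpa using f.apply_mul 1 ⟨x, hx⟩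

/-- Evaluation at `x`, as a bounded operator. -/
def evalCLM (σ : UnitaryRep H K) (x : G) : InducedSpace σ →L[ℂ] K :=
  LinearMap.mkContinuous
    { toFun := fun f => f x, map_add' := fun _ _ => rfl, map_smul' := fun _ _ => rfl } 1
    fun f => by rw [one_mul]; exact norm_apply_le f x

@[simp]
theorem evalCLM_apply (x : G) (f : InducedSpace σ) : evalCLM σ x f = f x := rfl

theorem out_mem_iff (q : G ⧸ H) : q.out ∈ H ↔ q = ((1 : G) : G ⧸ H) := by
  rw [← QuotientGroup.out_eq' q, eq_comm, QuotientGroup.eq, QuotientGroup.out_eq']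
  simp

open Classical in
/-- The element of the induced space that is supported on `H` and takes the value `k` at `1`. -/
def bump (σ : UnitaryRep H K) (k : K) : InducedSpace σ :=
  mk (fun x => if hx : x ∈ H then σ ⟨x, hx⟩⁻¹ k else 0)
    (fun x h => by
      by_cases hx : x ∈ H
      · have hxh : x * h ∈ H := H.mul_mem hx h.2
        have hinv : (⟨x * h, hxh⟩ : H)⁻¹ = h⁻¹ * ⟨x, hx⟩⁻¹ := by
          rw [← mul_inv_rev]
          rfl
        rw [dif_pos hx, dif_pos hxh, hinv, map_mul]
        rfl
      · have hxh : x * h ∉ H := fun hh => hx ((H.mul_mem_cancel_right h.2).mp hh)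
        simp [hx, hxh])
    (summable_of_hasFiniteSupport ((Set.finite_singleton ((1 : G) : G ⧸ H)).subset fun q hq => by
      by_contra hne
      have hout : q.out ∉ H := fun h => hne ((out_mem_iff q).mp h)
      simp [hout] at hq))

theorem bump_apply_of_mem (k : K) {x : G} (hx : x ∈ H) : bump σ k x = σ ⟨x, hx⟩⁻¹ k := by
  simp only [bump, mk_apply, dif_pos hx]

theorem bump_apply_of_notMem (k : K) {x : G} (hx : x ∉ H) : bump σ k x = 0 := by
  simp only [bump, mk_apply, dif_neg hx]

theorem bump_apply_one (k : K) : bump σ k 1 = k := by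
  have hone : (⟨1, H.one_mem⟩ : H)⁻¹ = 1 := inv_one
  rw [bump_apply_of_mem k H.one_mem, hone, map_one, LinearIsometryEquiv.coe_one, id_eq]

theorem inner_bump_left (k : K) (f : InducedSpace σ) : ⟪bump σ k, f⟫_ℂ = ⟪k, f 1⟫_ℂ := by
  rw [inner_def, tsum_eq_single ((1 : G) : G ⧸ H)]
  · have hout := (out_mem_iff ((1 : G) : G ⧸ H)).mpr rfl
    rw [f.apply_of_mem hout, bump_apply_of_mem k hout, LinearIsometryEquiv.inner_map_map]
  · intro q hq
    rw [bump_apply_of_notMem k (fun h => hq ((out_mem_iff q).mp h)), inner_zero_left]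

/-- The isometric embedding of the space of `σ` into that of `Ind_H^G σ` as the functions supported
on `H`. -/
def inclCLM (σ : UnitaryRep H K) : K →L[ℂ] InducedSpace σ :=
  LinearMap.mkContinuous
    { toFun := bump σ
      map_add' := fun a b => by
        ext x
        by_cases hx : x ∈ H
        · simp [bump_apply_of_mem, hx]
        · simp [bump_apply_of_notMem, hx]
      map_smul' := fun c a => by
        ext x
        by_cases hx : x ∈ H
        · simp [bump_apply_of_mem, hx]
        · simp [bump_apply_of_notMem, hx] } 1
    fun k => by
      rw [one_mul]
      change ‖bump σ k‖ ≤ ‖k‖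
      rw [@norm_eq_sqrt_re_inner ℂ, @norm_eq_sqrt_re_inner ℂ, inner_bump_left, bump_apply_one]

@[simp]
theorem inclCLM_apply_one (k : K) : inclCLM σ k 1 = k := bump_apply_one k

instance [Nontrivial K] : Nontrivial (InducedSpace σ) :=
  (Function.LeftInverse.injective (f := inclCLM σ) (g := evalCLM σ 1)
    inclCLM_apply_one).nontrivial

theorem inner_inclCLM_left (k : K) (f : InducedSpace σ) : ⟪inclCLM σ k, f⟫_ℂ = ⟪k, f 1⟫_ℂ :=
  inner_bump_left k f

theorem inner_induced_inclCLM_left (g : G) (k : K) (f : InducedSpace σ) :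
    ⟪induced σ g (inclCLM σ k), f⟫_ℂ = ⟪k, f g⟫_ℂ := by
  rw [inner_rep_left, inner_inclCLM_left, induced_apply, inv_inv, mul_one]

variable (σ) in
/-- The restriction of `Ind_H^G σ` to `H`. -/
abbrev restricted : UnitaryRep H (InducedSpace σ) := (induced σ).comp H.subtype

theorem intertwines_inclCLM : Intertwines σ (restricted σ) (inclCLM σ) := by
  intro h k
  refine ext_inner_right ℂ fun f => ?_
  change _ = ⟪induced σ (h : G) (inclCLM σ k), f⟫_ℂ
  rw [inner_induced_inclCLM_left, inner_inclCLM_left, inner_rep_left, f.apply_of_mem h.2]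

theorem intertwines_evalCLM_one : Intertwines (restricted σ) σ (evalCLM σ 1) := by
  intro h f
  change f ((h : G)⁻¹ * 1) = σ h (f 1)
  simpa using f.apply_mul 1 h⁻¹

theorem eq_top_of_induced_inclCLM_mem [CompleteSpace K] {S : Submodule ℂ (InducedSpace σ)}
    (hSc : IsClosed (S : Set (InducedSpace σ))) (hS : ∀ g k, induced σ g (inclCLM σ k) ∈ S) :
    S = ⊤ := by
  have : CompleteSpace S := hSc.completeSpace_coe
  rw [← Submodule.orthogonal_eq_bot_iff, Submodule.eq_bot_iff]
  intro f hf
  ext g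
  have horth := (Submodule.mem_orthogonal S f).mp hf _ (hS g (f g))
  rwa [inner_induced_inclCLM_left, inner_self_eq_zero] at horth

/-- The operator on the induced space that acts as `B` on the functions supported on `H` and
annihilates the functions supported off `H`. -/
def corner (σ : UnitaryRep H K) (B : K →L[ℂ] K) : InducedSpace σ →L[ℂ] InducedSpace σ :=
  inclCLM σ ∘L B ∘L evalCLM σ 1

@[simp]
theorem corner_apply (B : K →L[ℂ] K) (f : InducedSpace σ) :
    corner σ B f = inclCLM σ (B (f 1)) := rfl

theorem corner_mul_groupAlgebraHom (B : K →L[ℂ] K) (a : MonoidAlgebra ℂ H) :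
    corner σ B * groupAlgebraHom (restricted σ) a = corner σ (B * groupAlgebraHom σ a) := by
  ext1 f
  have heval : groupAlgebraHom (restricted σ) a f 1 = groupAlgebraHom σ a (f 1) :=
    intertwines_evalCLM_one.groupAlgebraHom_apply a f
  simp only [mul_apply_eq_comp, corner_apply, heval]

theorem groupAlgebraHom_mul_corner (a : MonoidAlgebra ℂ H) (B : K →L[ℂ] K) :
    groupAlgebraHom (restricted σ) a * corner σ B = corner σ (groupAlgebraHom σ a * B) := by
  ext1 f
  exact (intertwines_inclCLM.groupAlgebraHom_apply a (B (f 1))).symm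

theorem groupAlgebraHom_restricted_mem_cstarAlgebra [CompleteSpace K] (a : MonoidAlgebra ℂ H) :
    groupAlgebraHom (restricted σ) a ∈ cstarAlgebra (induced σ) := by
  rw [groupAlgebraHom_comp]
  exact groupAlgebraHom_mem_cstarAlgebra _ _

end InducedSpace

section SpectralGap

variable {G : Type u} [Group G] {E : Type v} [NormedAddCommGroup E] [InnerProductSpace ℂ E]

theorem norm_groupAlgebraHom_sub_le (π : UnitaryRep G E) (a : MonoidAlgebra ℂ G) (ξ : E) :
    ‖groupAlgebraHom π a ξ - groupAlgebraHom (trivial G) a 1 • ξ‖ ≤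
      ∑ s ∈ a.coeff.support, ‖a.coeff s‖ * ‖π s ξ - ξ‖ := by
  have hπ : groupAlgebraHom π a ξ = ∑ s ∈ a.coeff.support, a.coeff s • π s ξ := by
    simp [groupAlgebraHom, MonoidAlgebra.lift_apply, Finsupp.sum]
  have htriv : groupAlgebraHom (trivial G) a 1 = ∑ s ∈ a.coeff.support, a.coeff s := by
    simp [groupAlgebraHom, MonoidAlgebra.lift_apply, Finsupp.sum, trivial]
  rw [hπ, htriv, Finset.sum_smul, ← Finset.sum_sub_distrib]
  refine (norm_sum_le _ _).trans (Finset.sum_le_sum fun s _ => ?_)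
  rw [← smul_sub, norm_smul]

theorem exists_norm_sq_le_sum_of_not_weaklyContained {π : UnitaryRep G E}
    (hπ : ¬ WeaklyContained (trivial G) π) :
    ∃ (S : Finset G) (C : ℝ), 0 ≤ C ∧ ∀ ξ, ‖ξ‖ ^ 2 ≤ C * ∑ s ∈ S, ‖π s ξ - ξ‖ ^ 2 := by
  obtain ⟨a, ha⟩ : ∃ a, ‖groupAlgebraHom π a‖ < ‖groupAlgebraHom (trivial G) a‖ := by
    simpa [WeaklyContained] using hπ
  set t := groupAlgebraHom (trivial G) a 1
  have ht : ‖groupAlgebraHom (trivial G) a‖ = ‖t‖ := by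
    rw [← ContinuousLinearMap.norm_toSpanSingleton (𝕜 := ℂ) t,
      ContinuousLinearMap.toSpanSingleton_apply_map_one]
  set c := ‖t‖ - ‖groupAlgebraHom π a‖
  have hc : 0 < c := by linarith
  refine ⟨a.coeff.support, (∑ s ∈ a.coeff.support, ‖a.coeff s‖ ^ 2) / c ^ 2, by positivity,
    fun ξ => ?_⟩
  have hle : c * ‖ξ‖ ≤ ∑ s ∈ a.coeff.support, ‖a.coeff s‖ * ‖π s ξ - ξ‖ :=
    calc c * ‖ξ‖ ≤ ‖t • ξ‖ - ‖groupAlgebraHom π a ξ‖ := by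
          rw [sub_mul, norm_smul]
          exact sub_le_sub_left ((groupAlgebraHom π a).le_opNorm ξ) _
      _ ≤ ‖groupAlgebraHom π a ξ - t • ξ‖ := by
          rw [norm_sub_rev]
          exact norm_sub_norm_le _ _
      _ ≤ _ := norm_groupAlgebraHom_sub_le π a ξ
  rw [div_mul_eq_mul_div, le_div_iff₀ (by positivity), mul_comm, ← mul_pow]
  exact (pow_le_pow_left₀ (by positivity) hle 2).trans (Finset.sum_mul_sq_le_sq_mul_sq _ _ _)

theorem eq_zero_of_not_weaklyContained_trivial {π : UnitaryRep G E}
    (hπ : ¬ WeaklyContained (trivial G) π) {ξ : E} (hξ : ∀ g, π g ξ = ξ) : ξ = 0 := by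
  obtain ⟨S, C, -, hS⟩ := exists_norm_sq_le_sum_of_not_weaklyContained hπ
  have hle := hS ξ
  simp only [hξ, sub_self, norm_zero, ne_eq, OfNat.ofNat_ne_zero, not_false_eq_true, zero_pow,
    Finset.sum_const_zero, mul_zero] at hle
  exact norm_eq_zero.mp (pow_eq_zero_iff two_ne_zero |>.mp (le_antisymm hle (sq_nonneg _)))

end SpectralGap

section Slices

theorem norm_sq_lp_eq_tsum {ι : Type*} {E : ι → Type*} [∀ i, NormedAddCommGroup (E i)]
    (f : lp E 2) : ‖f‖ ^ 2 = ∑' i, ‖f i‖ ^ 2 := by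
  simpa using lp.norm_rpow_eq_tsum (p := 2) (by norm_num) f

theorem summable_norm_sq_lp {ι : Type*} {E : ι → Type*} [∀ i, NormedAddCommGroup (E i)]
    (f : lp E 2) : Summable fun i => ‖f i‖ ^ 2 := by
  simpa using (memℓp_gen_iff (p := 2) (by norm_num)).mp (lp.memℓp f)

variable {M : Type w} [NormedAddCommGroup M] [InnerProductSpace ℂ M]

theorem opNorm_sq_le_sum_norm_sq {F : Type*} [NormedAddCommGroup F] [NormedSpace ℂ F] {ι : Type*}
    [Fintype ι] (b : OrthonormalBasis ι ℂ M) (A : M →L[ℂ] F) :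
    ‖A‖ ^ 2 ≤ ∑ i, ‖A (b i)‖ ^ 2 := by
  have hle (x : M) : ‖A x‖ ≤ √(∑ i, ‖A (b i)‖ ^ 2) * ‖x‖ :=
    calc ‖A x‖ ≤ ∑ i, ‖A (b i)‖ * ‖⟪b i, x⟫_ℂ‖ := by
          conv_lhs => rw [← b.sum_repr' x, map_sum]
          refine (norm_sum_le _ _).trans (Finset.sum_le_sum fun i _ => ?_)
          rw [map_smul, norm_smul, mul_comm]
      _ ≤ √(∑ i, ‖A (b i)‖ ^ 2) * √(∑ i, ‖⟪b i, x⟫_ℂ‖ ^ 2) := Real.sum_mul_le_sqrt_mul_sqrt _ _ _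
      _ = √(∑ i, ‖A (b i)‖ ^ 2) * ‖x‖ := by
          rw [b.sum_sq_norm_inner_right, Real.sqrt_sq (norm_nonneg x)]
  calc ‖A‖ ^ 2 ≤ √(∑ i, ‖A (b i)‖ ^ 2) ^ 2 :=
        pow_le_pow_left₀ (norm_nonneg _) (A.opNorm_le_bound (Real.sqrt_nonneg _) hle) 2
    _ = ∑ i, ‖A (b i)‖ ^ 2 := Real.sq_sqrt (by positivity)

variable {G : Type u} [Group G] {H : Subgroup G}
variable {K : Type v} [NormedAddCommGroup K] [InnerProductSpace ℂ K] {σ : UnitaryRep H K}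

namespace InducedSpace

/-- The operator norm of the value at `x` of a family `T` of vectors of the induced space, that is,
of a linear map with values there. It depends only on the coset `xH` and is unchanged when the
family is reparametrized by a unitary. -/
def sliceNorm (T : M →L[ℂ] InducedSpace σ) (x : G) : ℝ := ‖evalCLM σ x ∘L T‖

theorem sliceNorm_congr (T : M →L[ℂ] InducedSpace σ) {x y : G} (hxy : (x : G ⧸ H) = y) :
    sliceNorm T x = sliceNorm T y := by
  have hle {x y : G} (hxy : (x : G ⧸ H) = y) : sliceNorm T x ≤ sliceNorm T y := by
    refine ContinuousLinearMap.opNorm_le_bound _ (norm_nonneg _) fun m => ?_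
    calc ‖T m x‖ = ‖T m y‖ := norm_apply_eq (T m) hxy
      _ ≤ sliceNorm T y * ‖m‖ := (evalCLM σ y ∘L T).le_opNorm m
  exact le_antisymm (hle hxy) (hle hxy.symm)

theorem sliceNorm_sq_le {ι : Type*} [Fintype ι] (b : OrthonormalBasis ι ℂ M)
    (T : M →L[ℂ] InducedSpace σ) (x : G) : sliceNorm T x ^ 2 ≤ ∑ i, ‖T (b i) x‖ ^ 2 :=
  opNorm_sq_le_sum_norm_sq b _

variable [FiniteDimensional ℂ M]

theorem summable_sliceNorm_sq (T : M →L[ℂ] InducedSpace σ) :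
    Summable fun q : G ⧸ H => sliceNorm T q.out ^ 2 :=
  Summable.of_nonneg_of_le (fun _ => by positivity)
    (fun q => sliceNorm_sq_le (stdOrthonormalBasis ℂ M) T q.out)
    (summable_sum fun i _ => (T (stdOrthonormalBasis ℂ M i)).summable_norm_sq)

/-- The slice norms of `T` on the cosets other than `H`, as a vector of the representation whose
spectral gap is given. -/
def sliceLp (T : M →L[ℂ] InducedSpace σ) : lp (fun _ : cosetsAwayFromBase H => ℂ) 2 :=
  ⟨fun q => (sliceNorm T q.1.out : ℂ), by
    refine (memℓp_gen_iff (by norm_num)).mpr ?_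
    simpa [Function.comp_def] using! (summable_sliceNorm_sq T).comp_injective
      (Subtype.val_injective (p := (· ∈ cosetsAwayFromBase H)))⟩

theorem sliceLp_apply (T : M →L[ℂ] InducedSpace σ) (q : cosetsAwayFromBase H) :
    sliceLp T q = (sliceNorm T q.1.out : ℂ) := rfl

theorem norm_sliceLp_apply (T : M →L[ℂ] InducedSpace σ) (q : cosetsAwayFromBase H) :
    ‖sliceLp T q‖ = sliceNorm T q.1.out := by
  rw [sliceLp_apply, Complex.norm_real, sliceNorm, norm_norm]

theorem permutation_sliceLp (T : M →L[ℂ] InducedSpace σ) (h : H) :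
    permutation H (cosetsAwayFromBase H) h (sliceLp T) =
      sliceLp (toOperators (induced σ) (h : G) ∘L T) := by
  ext q
  rw [permutation_apply, sliceLp_apply, sliceLp_apply, Complex.ofReal_inj]
  change sliceNorm T (h⁻¹ • q).1.out = sliceNorm T ((h : G)⁻¹ * q.1.out)
  refine sliceNorm_congr T ?_
  rw [QuotientGroup.out_eq', ← smul_eq_mul, MulAction.Quotient.coe_smul_out]
  rfl

theorem sliceLp_comp_linearIsometryEquiv (T : M →L[ℂ] InducedSpace σ) (U : M ≃ₗᵢ[ℂ] M) :
    sliceLp (T ∘L (U.toContinuousLinearEquiv : M →L[ℂ] M)) = sliceLp T := by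
  ext q
  rw [sliceLp_apply, sliceLp_apply, Complex.ofReal_inj]
  exact ContinuousLinearMap.opNorm_comp_linearIsometryEquiv (evalCLM σ q.1.out ∘L T) U

theorem norm_apply_le_norm_sliceLp {T : M →L[ℂ] InducedSpace σ} (hT : ∀ m, T m 1 = 0) (m : M) :
    ‖T m‖ ≤ ‖sliceLp T‖ * ‖m‖ := by
  have hsupp : (Function.support fun q : G ⧸ H => ‖T m q.out‖ ^ 2) ⊆ cosetsAwayFromBase H := by
    intro q hq hq_base
    have hq_zero : ‖T m q.out‖ = ‖T m 1‖ := norm_apply_eq _ (by simpa using hq_base)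
    rw [hT, norm_zero] at hq_zero
    simp [hq_zero] at hq
  refine le_of_sq_le_sq ?_ (by positivity)
  rw [norm_sq_eq, mul_pow, norm_sq_lp_eq_tsum, ← tsum_mul_right,
    ← tsum_subtype_eq_of_support_subset hsupp]
  refine Summable.tsum_le_tsum (fun q => ?_)
    ((T m).summable_norm_sq.comp_injective Subtype.val_injective)
    ((summable_norm_sq_lp _).mul_right _)
  rw [norm_sliceLp_apply, ← mul_pow]
  exact pow_le_pow_left₀ (norm_nonneg _) ((evalCLM σ q.1.out ∘L T).le_opNorm m) 2

theorem norm_sliceLp_sub_sq_le {ι : Type*} [Fintype ι] (b : OrthonormalBasis ι ℂ M)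
    (T T' : M →L[ℂ] InducedSpace σ) :
    ‖sliceLp T - sliceLp T'‖ ^ 2 ≤ ∑ i, ‖T (b i) - T' (b i)‖ ^ 2 := by
  have hsum : Summable fun q : G ⧸ H => ∑ i, ‖(T - T') (b i) q.out‖ ^ 2 :=
    summable_sum fun i _ => ((T - T') (b i)).summable_norm_sq
  have hpoint (q : cosetsAwayFromBase H) :
      ‖(sliceLp T - sliceLp T') q‖ ≤ sliceNorm (T - T') q.1.out := by
    change ‖sliceLp T q - sliceLp T' q‖ ≤ _
    rw [sliceLp_apply, sliceLp_apply, ← Complex.ofReal_sub, Complex.norm_real]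
    simpa only [sliceNorm, ContinuousLinearMap.comp_sub, Real.norm_eq_abs] using
      abs_norm_sub_norm_le (evalCLM σ q.1.out ∘L T) (evalCLM σ q.1.out ∘L T')
  calc ‖sliceLp T - sliceLp T'‖ ^ 2
      = ∑' q, ‖(sliceLp T - sliceLp T') q‖ ^ 2 := norm_sq_lp_eq_tsum _
    _ ≤ ∑' q : cosetsAwayFromBase H, ∑ i, ‖(T - T') (b i) q.1.out‖ ^ 2 :=
        Summable.tsum_le_tsum
          (fun q => (pow_le_pow_left₀ (norm_nonneg _) (hpoint q) 2).trans (sliceNorm_sq_le b _ _))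
          (summable_norm_sq_lp _) (hsum.comp_injective Subtype.val_injective)
    _ ≤ ∑' q : G ⧸ H, ∑ i, ‖(T - T') (b i) q.out‖ ^ 2 :=
        Summable.tsum_subtype_le (fun q : G ⧸ H => ∑ i, ‖(T - T') (b i) q.out‖ ^ 2)
          (cosetsAwayFromBase H : Set (G ⧸ H)) (fun _ => by positivity) hsum
    _ = ∑ i, ‖T (b i) - T' (b i)‖ ^ 2 := by
        rw [Summable.tsum_finsetSum fun i _ => ((T - T') (b i)).summable_norm_sq]
        exact Finset.sum_congr rfl fun i _ => (norm_sq_eq _).symm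

/-- Compares `T` with the family `s ∘ T ∘ τ(s)⁻¹` through the slice norms. -/
theorem exists_norm_sq_le_sum (hH : HasSpectralGapProperty H) (τ : UnitaryRep H M)
    {ι : Type*} [Fintype ι] (b : OrthonormalBasis ι ℂ M) :
    ∃ (S : Finset H) (C : ℝ), 0 ≤ C ∧ ∀ T : M →L[ℂ] InducedSpace σ, (∀ m, T m 1 = 0) →
      ∀ i, ‖T (b i)‖ ^ 2 ≤
        C * ∑ s ∈ S, ∑ j, ‖restricted σ s (T (b j)) - T (τ s (b j))‖ ^ 2 := by
  obtain ⟨S, C, hC, hgap⟩ := exists_norm_sq_le_sum_of_not_weaklyContained hH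
  refine ⟨S, C, hC, fun T hT i => ?_⟩
  have hlow : ‖T (b i)‖ ≤ ‖sliceLp T‖ := by simpa using norm_apply_le_norm_sliceLp hT (b i)
  refine (pow_le_pow_left₀ (norm_nonneg _) hlow 2).trans ((hgap _).trans ?_)
  gcongr with s
  rw [permutation_sliceLp, ← sliceLp_comp_linearIsometryEquiv T (τ s)]
  exact norm_sliceLp_sub_sq_le b _ _

end InducedSpace

end Slices

section Annihilator

theorem norm_add_sum_sq_le {E : Type*} [SeminormedAddCommGroup E] {ι : Type*} [Fintype ι] (x : E)
    (y : ι → E) :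
    ‖x + ∑ i, y i‖ ^ 2 ≤ 2 * (‖x‖ ^ 2 + Fintype.card ι * ∑ i, ‖y i‖ ^ 2) := by
  have hsum : ‖∑ i, y i‖ ^ 2 ≤ Fintype.card ι * ∑ i, ‖y i‖ ^ 2 :=
    (pow_le_pow_left₀ (norm_nonneg _) (norm_sum_le _ _) 2).trans sq_sum_le_card_mul_sum_sq
  calc ‖x + ∑ i, y i‖ ^ 2 ≤ (‖x‖ + ‖∑ i, y i‖) ^ 2 :=
        pow_le_pow_left₀ (norm_nonneg _) (norm_add_le _ _) 2
    _ ≤ 2 * (‖x‖ ^ 2 + ‖∑ i, y i‖ ^ 2) := add_sq_le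
    _ ≤ _ := by gcongr

variable {G : Type u} [Group G]
variable {K : Type v} [NormedAddCommGroup K] [InnerProductSpace ℂ K] [FiniteDimensional ℂ K]
variable {E : Type w} [NormedAddCommGroup E] [InnerProductSpace ℂ E]

/-- The element is `∑ j, (d j)^* * d j`. -/
theorem exists_inner_groupAlgebraHom_eq_sum [CompleteSpace E] {σ : UnitaryRep G K}
    (ρ : UnitaryRep G E) {J : Type*} [Fintype J] {d : J → MonoidAlgebra ℂ G}
    (hd : ∀ j, groupAlgebraHom σ (d j) = 0) :
    ∃ D, groupAlgebraHom σ D = 0 ∧ 0 ≤ groupAlgebraHom ρ D ∧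
      ∀ f, RCLike.re ⟪f, groupAlgebraHom ρ D f⟫_ℂ = ∑ j, ‖groupAlgebraHom ρ (d j) f‖ ^ 2 := by
  have : CompleteSpace K := FiniteDimensional.complete ℂ K
  choose d' _ hd' using fun j => exists_groupAlgebraHom_eq_star σ ρ (d j)
  have hD : groupAlgebraHom ρ (∑ j, d' j * d j) =
      ∑ j, star (groupAlgebraHom ρ (d j)) * groupAlgebraHom ρ (d j) := by
    simp only [map_sum, map_mul, hd']
  refine ⟨∑ j, d' j * d j, by simp [hd], ?_, fun f => ?_⟩
  · rw [hD]
    exact Finset.sum_nonneg fun j _ => star_mul_self_nonneg _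
  · rw [hD, sum_apply, inner_sum, map_sum]
    refine Finset.sum_congr rfl fun j _ => ?_
    rw [ContinuousLinearMap.star_eq_adjoint, mul_apply_eq_comp,
      ContinuousLinearMap.adjoint_inner_right, inner_self_eq_norm_sq]

/-- Here `c` is a linear section of `σ : ℂ[G] → B(K)`, the `i`-th map sends `u` to
`ρ(c(u ⊗ bᵢ^*)) f`, and `d` collects the elements of `ℂ[G]` that measure how far these maps are from
being intertwining and from recovering `f`. -/
theorem IsIrreducible.exists_annihilating_family {σ : UnitaryRep G K} (hσ : σ.IsIrreducible)
    (ρ : UnitaryRep G E) {ι : Type*} [Fintype ι] (b : OrthonormalBasis ι ℂ K)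
    (S : Finset G) :
    ∃ d : Option (ι × S × ι) → MonoidAlgebra ℂ G, (∀ j, groupAlgebraHom σ (d j) = 0) ∧
      ∀ f, ∃ T : ι → K →L[ℂ] E, (∀ i u, ∃ a, T i u = groupAlgebraHom ρ a f) ∧
        groupAlgebraHom ρ (d none) f = f - ∑ i, T i (b i) ∧
        ∀ i s j, groupAlgebraHom ρ (d (some (i, s, j))) f =
          ρ s (T i (b j)) - T i (σ s (b j)) := by
  classical
  obtain ⟨c, hc⟩ := (groupAlgebraHom σ).toLinearMap.exists_rightInverse_of_surjective
    (LinearMap.range_eq_top.mpr hσ.groupAlgebraHom_surjective)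
  replace hc (B : K →L[ℂ] K) : groupAlgebraHom σ (c B) = B := LinearMap.congr_fun hc B
  let e (u : K) (i : ι) : K →L[ℂ] K := InnerProductSpace.rankOne ℂ u (b i)
  let d : Option (ι × S × ι) → MonoidAlgebra ℂ G
    | none => 1 - ∑ i, c (e (b i) i)
    | some (i, s, j) => MonoidAlgebra.single (s : G) 1 * c (e (b j) i) - c (e (σ s (b j)) i)
  refine ⟨d, ?_, fun f => ⟨fun i => LinearMap.toContinuousLinearMap
    { toFun := fun u => groupAlgebraHom ρ (c (e u i)) f
      map_add' := fun u u' => by simp [e]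
      map_smul' := fun r u => by simp [e] }, fun i u => ⟨c (e u i), rfl⟩, ?_, fun i s j => ?_⟩⟩
  · rintro (_ | ⟨i, s, j⟩)
    · simp [d, hc, e, b.sum_rankOne_eq_id, ContinuousLinearMap.one_def]
    · ext1 u
      simp [d, hc, e, mul_apply_eq_comp]
  · simp [d]
  · simp [d, mul_apply_eq_comp]

theorem IsIrreducible.exists_annihilator_of_gap [CompleteSpace E] {σ : UnitaryRep G K}
    (hσ : σ.IsIrreducible) {ρ : UnitaryRep G E} {N : Submodule ℂ E}
    (hN : ∀ g, ∀ x ∈ N, ρ g x ∈ N) {ι : Type*} [Fintype ι] (b : OrthonormalBasis ι ℂ K)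
    {S : Finset G} {C : ℝ} (hC : 0 ≤ C)
    (hgap : ∀ T : K →L[ℂ] E, (∀ u, T u ∈ N) → ∀ i,
      ‖T (b i)‖ ^ 2 ≤ C * ∑ s ∈ S, ∑ j, ‖ρ s (T (b j)) - T (σ s (b j))‖ ^ 2) :
    ∃ (D : MonoidAlgebra ℂ G) (C' : ℝ), 0 < C' ∧ groupAlgebraHom σ D = 0 ∧
      0 ≤ groupAlgebraHom ρ D ∧
      ∀ f ∈ N, ‖f‖ ^ 2 ≤ C' * RCLike.re ⟪f, groupAlgebraHom ρ D f⟫_ℂ := by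
  classical
  obtain ⟨d, hd, hT⟩ := hσ.exists_annihilating_family ρ b S
  obtain ⟨D, hσD, hD, hinner⟩ := exists_inner_groupAlgebraHom_eq_sum ρ hd
  refine ⟨D, 2 * (1 + Fintype.card ι * C), by positivity, hσD, hD, fun f hf => ?_⟩
  obtain ⟨T, hTa, hnone, hsome⟩ := hT f
  have hTN (i : ι) (u : K) : T i u ∈ N := by
    obtain ⟨a, ha⟩ := hTa i u
    exact ha ▸ groupAlgebraHom_apply_mem hN a hf
  set r := ‖groupAlgebraHom ρ (d none) f‖ ^ 2
  set R := ∑ i, ∑ s ∈ S, ∑ j, ‖ρ s (T i (b j)) - T i (σ s (b j))‖ ^ 2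
  have hsplit : RCLike.re ⟪f, groupAlgebraHom ρ D f⟫_ℂ = r + R := by
    simp only [hinner, Fintype.sum_option, Fintype.sum_prod_type, hsome, r, R]
    congr! 2 with i
    exact Finset.sum_coe_sort S fun s => ∑ j, ‖ρ s (T i (b j)) - T i (σ s (b j))‖ ^ 2
  have hR : ∑ i, ‖T i (b i)‖ ^ 2 ≤ C * R := by
    rw [Finset.mul_sum]
    exact Finset.sum_le_sum fun i _ => hgap (T i) (hTN i) i
  have hr0 : 0 ≤ r := by positivity
  have hR0 : 0 ≤ R := by positivity
  calc ‖f‖ ^ 2 = ‖groupAlgebraHom ρ (d none) f + ∑ i, T i (b i)‖ ^ 2 := by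
        rw [hnone, sub_add_cancel]
    _ ≤ 2 * (r + Fintype.card ι * ∑ i, ‖T i (b i)‖ ^ 2) := norm_add_sum_sq_le _ _
    _ ≤ 2 * (r + Fintype.card ι * (C * R)) := by gcongr
    _ ≤ 2 * (1 + Fintype.card ι * C) * (r + R) := by
        have hcross : 0 ≤ Fintype.card ι * C * r := mul_nonneg (by positivity) hr0
        nlinarith
    _ = _ := by rw [hsplit]

end Annihilator

section Contraction

theorem tendsto_pow_of_isIdempotentElem {𝕜 E : Type*} [NontriviallyNormedField 𝕜]
    [NormedAddCommGroup E] [NormedSpace 𝕜 E] {Q P : E →L[𝕜] E} (hP : IsIdempotentElem P)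
    (hQP : Q * P = P) (hPQ : P * Q = P) {r : ℝ} (hr0 : 0 ≤ r) (hr1 : r < 1)
    (hcontract : ∀ x, P x = 0 → ‖Q x‖ ≤ r * ‖x‖) : Tendsto (Q ^ ·) atTop (𝓝 P) := by
  have hpowP (n : ℕ) : Q ^ n * P = P := by
    induction n with
    | zero => rw [pow_zero, one_mul]
    | succ n ih => rw [pow_succ, mul_assoc, hQP, ih]
  have hPpow (n : ℕ) : P * Q ^ n = P := by
    induction n with
    | zero => rw [pow_zero, mul_one]
    | succ n ih => rw [pow_succ, ← mul_assoc, ih, hPQ]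
  have hpow (n : ℕ) {x : E} (hx : P x = 0) : ‖(Q ^ n) x‖ ≤ r ^ n * ‖x‖ := by
    induction n with
    | zero => simp
    | succ n ih =>
      have hker : P ((Q ^ n) x) = 0 := by rw [← mul_apply_eq_comp, hPpow, hx]
      rw [pow_succ', mul_apply_eq_comp, pow_succ', mul_assoc]
      exact (hcontract _ hker).trans (mul_le_mul_of_nonneg_left ih hr0)
  refine tendsto_iff_norm_sub_tendsto_zero.mpr (squeeze_zero (fun _ => norm_nonneg _)
    (fun n => ContinuousLinearMap.opNorm_le_bound _ (by positivity) fun x => ?_)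
    (g := fun n => r ^ n * ‖(1 : E →L[𝕜] E) - P‖) ?_)
  · have hker : P ((1 - P) x) = 0 := by
      rw [← mul_apply_eq_comp, mul_sub, mul_one, hP.eq, sub_self, zero_apply]
    have hdecomp : (Q ^ n - P) x = (Q ^ n) ((1 - P) x) := by
      rw [← mul_apply_eq_comp, mul_sub, mul_one, hpowP]
    rw [hdecomp, mul_assoc]
    exact (hpow n hker).trans (mul_le_mul_of_nonneg_left ((1 - P).le_opNorm x) (by positivity))
  · simpa using (tendsto_pow_atTop_nhds_zero_of_lt_one hr0 hr1).mul_const ‖(1 : E →L[𝕜] E) - P‖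

variable {E : Type v} [NormedAddCommGroup E] [InnerProductSpace ℂ E] [CompleteSpace E]

theorem norm_apply_sq_le_of_nonneg {D : E →L[ℂ] E} (hD : 0 ≤ D) (x : E) :
    ‖D x‖ ^ 2 ≤ ‖D‖ * RCLike.re ⟪x, D x⟫_ℂ := by
  obtain ⟨R, rfl⟩ := CStarAlgebra.nonneg_iff_eq_star_mul_self.mp hD
  have hre : RCLike.re ⟪x, (star R * R) x⟫_ℂ = ‖R x‖ ^ 2 := by
    rw [mul_apply_eq_comp, ContinuousLinearMap.star_eq_adjoint,
      ContinuousLinearMap.adjoint_inner_right, inner_self_eq_norm_sq]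
  rw [hre, CStarRing.norm_star_mul_self, ← sq, ← mul_pow, ← norm_star R]
  exact pow_le_pow_left₀ (norm_nonneg _) ((star R).le_opNorm (R x)) 2

theorem norm_sub_smul_apply_sq_le {D : E →L[ℂ] E} (hD : 0 ≤ D) {t : ℝ} (ht : 0 ≤ t)
    (htD : t * ‖D‖ ≤ 1) (x : E) :
    ‖x - (t : ℂ) • D x‖ ^ 2 ≤ ‖x‖ ^ 2 - t * RCLike.re ⟪x, D x⟫_ℂ := by
  have hre : 0 ≤ RCLike.re ⟪x, D x⟫_ℂ :=
    ((ContinuousLinearMap.nonneg_iff_isPositive D).mp hD).re_inner_nonneg_right x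
  have hsq : t ^ 2 * ‖D x‖ ^ 2 ≤ t * RCLike.re ⟪x, D x⟫_ℂ :=
    calc t ^ 2 * ‖D x‖ ^ 2 ≤ t ^ 2 * (‖D‖ * RCLike.re ⟪x, D x⟫_ℂ) := by
          gcongr
          exact norm_apply_sq_le_of_nonneg hD x
      _ = (t * ‖D‖) * (t * RCLike.re ⟪x, D x⟫_ℂ) := by ring
      _ ≤ t * RCLike.re ⟪x, D x⟫_ℂ := mul_le_of_le_one_left (by positivity) htD
  have hcross : RCLike.re ⟪x, (t : ℂ) • D x⟫_ℂ = t * RCLike.re ⟪x, D x⟫_ℂ := by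
    rw [inner_smul_right]
    exact Complex.re_ofReal_mul _ _
  rw [@norm_sub_sq ℂ, hcross, norm_smul, mul_pow, Complex.norm_real, Real.norm_eq_abs, sq_abs]
  linarith

/-- The powers of `1 - t • D`, for small `t > 0`, converge to `P`. -/
theorem mem_of_isIdempotentElem_of_gap {A : Subalgebra ℂ (E →L[ℂ] E)}
    (hA : IsClosed (A : Set (E →L[ℂ] E))) {D P : E →L[ℂ] E} (hDA : D ∈ A) (hD : 0 ≤ D)
    (hP : IsIdempotentElem P) (hDP : D * P = 0) (hPD : P * D = 0) {C : ℝ} (hC : 0 < C)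
    (hgap : ∀ x, P x = 0 → ‖x‖ ^ 2 ≤ C * RCLike.re ⟪x, D x⟫_ℂ) : P ∈ A := by
  set t : ℝ := (‖D‖ + 1)⁻¹
  have ht : 0 < t := by positivity
  have htD : t * ‖D‖ ≤ 1 := by
    rw [inv_mul_le_iff₀ (by positivity)]
    linarith
  set Q : E →L[ℂ] E := 1 - (t : ℂ) • D
  have hQA : Q ∈ A := A.sub_mem A.one_mem (A.smul_mem hDA _)
  have hQP : Q * P = P := by rw [sub_mul, one_mul, smul_mul_assoc, hDP, smul_zero, sub_zero]
  have hPQ : P * Q = P := by rw [mul_sub, mul_one, mul_smul_comm, hPD, smul_zero, sub_zero]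
  have hcontract (x : E) (hx : P x = 0) : ‖Q x‖ ≤ √(1 - t / C) * ‖x‖ := by
    rw [← Real.sqrt_sq (norm_nonneg x), ← Real.sqrt_mul' _ (sq_nonneg _)]
    refine Real.le_sqrt_of_sq_le ((norm_sub_smul_apply_sq_le hD ht.le htD x).trans ?_)
    have hle : t / C * ‖x‖ ^ 2 ≤ t * RCLike.re ⟪x, D x⟫_ℂ := by
      rw [div_mul_eq_mul_div, div_le_iff₀ hC]
      linarith [mul_le_mul_of_nonneg_left (hgap x hx) ht.le]
    linarith
  have hr : √(1 - t / C) < 1 := by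
    rw [Real.sqrt_lt' one_pos, one_pow]
    linarith [div_pos ht hC]
  exact hA.mem_of_tendsto
    (tendsto_pow_of_isIdempotentElem hP hQP hPQ (Real.sqrt_nonneg _) hr hcontract)
    (Eventually.of_forall fun n => A.pow_mem hQA n)

end Contraction

section Compact

variable {E : Type v} [NormedAddCommGroup E] [InnerProductSpace ℂ E] [CompleteSpace E]

theorem norm_sub_starProjection_apply_le {F : Type*} [NormedAddCommGroup F] [InnerProductSpace ℂ F]
    (V : Submodule ℂ F) [V.HasOrthogonalProjection] (x : F) {y : F} (hy : y ∈ V) :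
    ‖x - V.starProjection x‖ ≤ ‖x - y‖ := by
  rw [Submodule.starProjection_minimal]
  exact ciInf_le ⟨0, Set.forall_mem_range.mpr fun _ => norm_nonneg _⟩ (⟨y, hy⟩ : V)

theorem mem_of_isCompactOperator {A : Submodule ℂ (E →L[ℂ] E)}
    (hA : IsClosed (A : Set (E →L[ℂ] E)))
    (hrank : ∀ x y : E, InnerProductSpace.rankOne ℂ x y ∈ A) {T : E →L[ℂ] E}
    (hT : IsCompactOperator T) : T ∈ A := by
  rw [← SetLike.mem_coe, ← hA.closure_eq, Metric.mem_closure_iff]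
  intro ε hε
  have hcpt : IsCompact (closure (T '' Metric.closedBall 0 1)) :=
    IsCompactOperator.isCompact_closure_image_closedBall (f := (T : E →ₗ[ℂ] E)) hT 1
  obtain ⟨t, ht, hcover⟩ := Metric.totallyBounded_iff.mp hcpt.totallyBounded (ε / 2) (by positivity)
  let V := Submodule.span ℂ t
  have : FiniteDimensional ℂ V := FiniteDimensional.span_of_finite ℂ ht
  refine ⟨V.starProjection ∘L T, ?_, ?_⟩
  · rw [(stdOrthonormalBasis ℂ V).starProjection_eq_sum_rankOne, SetLike.mem_coe,
      ContinuousLinearMap.finsetSum_comp]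
    refine sum_mem fun i _ => ?_
    rw [InnerProductSpace.rankOne_comp]
    exact hrank _ _
  · refine lt_of_le_of_lt ?_ (half_lt_self hε)
    rw [dist_eq_norm]
    refine ContinuousLinearMap.opNorm_le_of_unit_norm (by positivity) fun x hx => ?_
    have hmem : T x ∈ closure (T '' Metric.closedBall 0 1) := subset_closure ⟨x, by simp [hx], rfl⟩
    obtain ⟨y, hy, hxy⟩ := Set.mem_iUnion₂.mp (hcover hmem)
    rw [Metric.mem_ball, dist_eq_norm] at hxy
    exact (norm_sub_starProjection_apply_le V (T x) (Submodule.subset_span hy)).trans hxy.le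

theorem rankOne_mem_of_dense_span {A : Submodule ℂ (E →L[ℂ] E)}
    (hA : IsClosed (A : Set (E →L[ℂ] E))) {s : Set E}
    (hs : (Submodule.span ℂ s).topologicalClosure = ⊤)
    (hrank : ∀ x ∈ s, ∀ y ∈ s, InnerProductSpace.rankOne ℂ x y ∈ A) (x y : E) :
    InnerProductSpace.rankOne ℂ x y ∈ A := by
  have hspan : ∀ x ∈ Submodule.span ℂ s, ∀ y ∈ Submodule.span ℂ s,
      InnerProductSpace.rankOne ℂ x y ∈ A := by
    intro x hx y hy
    induction hx, hy using Submodule.span_induction₂ with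
    | mem_mem x y hx hy => exact hrank x hx y hy
    | zero_left => simp
    | zero_right => simp
    | add_left x x' y _ _ _ h h' => simpa using A.add_mem h h'
    | add_right x y y' _ _ _ h h' => simpa using A.add_mem h h'
    | smul_left c x y _ _ h => simpa using A.smul_mem c h
    | smul_right c x y _ _ h => simpa using A.smul_mem (star c) h
  have hdense (z : E) : z ∈ closure (Submodule.span ℂ s : Set E) := by
    rw [← Submodule.topologicalClosure_coe, hs]
    trivial
  have hcont : Continuous (Function.uncurry fun x y : E => InnerProductSpace.rankOne ℂ x y) :=
    (ContinuousLinearMap.smulRightL ℂ E E).continuous₂.comp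
      (((innerSL ℂ).continuous.comp continuous_snd).prodMk continuous_fst)
  rw [← SetLike.mem_coe, ← hA.closure_eq]
  exact map_mem_closure₂ (f := fun x y => InnerProductSpace.rankOne ℂ x y) hcont
    (hdense x) (hdense y) hspan

end Compact

section InducedCompacts

variable {G : Type u} [Group G] {H : Subgroup G}
variable {K : Type v} [NormedAddCommGroup K] [InnerProductSpace ℂ K] {σ : UnitaryRep H K}

namespace InducedSpace

theorem corner_zero : corner σ 0 = 0 := by
  ext1 f
  simp

theorem isIdempotentElem_corner_one : IsIdempotentElem (corner σ 1) := by
  ext1 f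
  simp [mul_apply_eq_comp]

theorem toOperators_mul_corner_mul_toOperators (g g' : G) (k k' : K) :
    toOperators (induced σ) g * corner σ (InnerProductSpace.rankOne ℂ k k') *
        toOperators (induced σ) g'⁻¹ =
      InnerProductSpace.rankOne ℂ (induced σ g (inclCLM σ k)) (induced σ g' (inclCLM σ k')) := by
  ext1 f
  simp [mul_apply_eq_comp, inner_induced_inclCLM_left, -map_inv]

variable [FiniteDimensional ℂ K] [CompleteSpace K]

theorem corner_one_mem_cstarAlgebra (hH : HasSpectralGapProperty H) (hσ : σ.IsIrreducible) :
    corner σ 1 ∈ cstarAlgebra (induced σ) := by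
  let N : Submodule ℂ (InducedSpace σ) := (evalCLM σ 1).ker
  have hN (h : H) : ∀ f ∈ N, restricted σ h f ∈ N := fun f (hf : f 1 = 0) => by
    change evalCLM σ 1 (restricted σ h f) = 0
    rw [intertwines_evalCLM_one, evalCLM_apply, hf, map_zero]
  obtain ⟨S, C, hC, hgap⟩ := exists_norm_sq_le_sum hH σ (stdOrthonormalBasis ℂ K) (σ := σ)
  obtain ⟨D, C', hC', hσD, hD, hbelow⟩ := hσ.exists_annihilator_of_gap hN _ hC hgap
  refine mem_of_isIdempotentElem_of_gap (A := (cstarAlgebra (induced σ)).toSubalgebra)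
    (isClosed_cstarAlgebra _) (groupAlgebraHom_restricted_mem_cstarAlgebra D) hD
    isIdempotentElem_corner_one ?_ ?_ hC' fun f hf => hbelow f ?_
  · rw [groupAlgebraHom_mul_corner, hσD, zero_mul, corner_zero]
  · rw [corner_mul_groupAlgebraHom, hσD, mul_zero, corner_zero]
  · change f 1 = 0
    simpa using congrArg (evalCLM σ 1) hf

theorem corner_mem_cstarAlgebra (hH : HasSpectralGapProperty H) (hσ : σ.IsIrreducible)
    (B : K →L[ℂ] K) : corner σ B ∈ cstarAlgebra (induced σ) := by
  obtain ⟨a, rfl⟩ := hσ.groupAlgebraHom_surjective B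
  rw [← one_mul (groupAlgebraHom σ a), ← corner_mul_groupAlgebraHom]
  exact mul_mem (corner_one_mem_cstarAlgebra hH hσ) (groupAlgebraHom_restricted_mem_cstarAlgebra a)

end InducedSpace

open InducedSpace in
theorem HasSpectralGapProperty.containsCompacts_induced [FiniteDimensional ℂ K]
    (hH : HasSpectralGapProperty H) (hσ : σ.IsIrreducible) : ContainsCompacts (induced σ) := by
  have : CompleteSpace K := FiniteDimensional.complete ℂ K
  let s : Set (InducedSpace σ) := {f | ∃ g k, induced σ g (inclCLM σ k) = f}
  have hs : (Submodule.span ℂ s).topologicalClosure = ⊤ :=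
    eq_top_of_induced_inclCLM_mem (Submodule.isClosed_topologicalClosure _) fun g k =>
      Submodule.le_topologicalClosure _ (Submodule.subset_span ⟨g, k, rfl⟩)
  have hrank : ∀ x ∈ s, ∀ y ∈ s, InnerProductSpace.rankOne ℂ x y ∈ cstarAlgebra (induced σ) := by
    rintro _ ⟨g, k, rfl⟩ _ ⟨g', k', rfl⟩
    rw [← toOperators_mul_corner_mul_toOperators]
    exact mul_mem (mul_mem (toOperators_mem_cstarAlgebra _ g) (corner_mem_cstarAlgebra hH hσ _))
      (toOperators_mem_cstarAlgebra _ _)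
  let A := Subalgebra.toSubmodule (cstarAlgebra (induced σ)).toSubalgebra
  have hA : IsClosed (A : Set (InducedSpace σ →L[ℂ] InducedSpace σ)) := isClosed_cstarAlgebra _
  exact fun T hT => mem_cstarAlgebra.mp
    (mem_of_isCompactOperator hA (rankOne_mem_of_dense_span hA hs hrank) hT)

end InducedCompacts

section MonotoneConvergence

variable {E : Type v} [NormedAddCommGroup E] [InnerProductSpace ℂ E]

theorem re_inner_le_of_le {T T' : E →L[ℂ] E} (hT : T ≤ T') (x : E) :
    RCLike.re ⟪x, T x⟫_ℂ ≤ RCLike.re ⟪x, T' x⟫_ℂ := by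
  have hnonneg := ((ContinuousLinearMap.le_def T T').mp hT).re_inner_nonneg_right x
  rw [sub_apply, inner_sub_right, map_sub] at hnonneg
  linarith

theorem re_inner_nonneg {T : E →L[ℂ] E} (hT : 0 ≤ T) (x : E) : 0 ≤ RCLike.re ⟪x, T x⟫_ℂ := by
  simpa using re_inner_le_of_le hT x

theorem isPositive_of_tendsto {ι : Type*} {l : Filter ι} [l.NeBot] {T : ι → E →L[ℂ] E}
    {S : E →L[ℂ] E} (hlim : ∀ x, Tendsto (fun i => T i x) l (𝓝 (S x)))
    (hT : ∀ᶠ i in l, (T i).IsPositive) : S.IsPositive := by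
  rw [ContinuousLinearMap.isPositive_iff_complex]
  intro x
  have hclosed : IsClosed {z : ℂ | ((RCLike.re z : ℝ) : ℂ) = z ∧ 0 ≤ RCLike.re z} :=
    (isClosed_eq (Complex.continuous_ofReal.comp Complex.continuous_re) continuous_id).inter
      (isClosed_le continuous_const Complex.continuous_re)
  refine hclosed.mem_of_tendsto ((hlim x).inner tendsto_const_nhds) ?_
  filter_upwards [hT] with i hi
  exact (ContinuousLinearMap.isPositive_iff_complex _).mp hi x

variable [CompleteSpace E]

theorem norm_sub_apply_sq_le {R T S : E →L[ℂ] E} (hR : 0 ≤ R) (hRT : R ≤ T) (hTS : T ≤ S) (x : E) :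
    ‖T x - R x‖ ^ 2 ≤ ‖S‖ * (RCLike.re ⟪x, T x⟫_ℂ - RCLike.re ⟪x, R x⟫_ℂ) := by
  have hdiff : 0 ≤ T - R := sub_nonneg.mpr hRT
  have hnorm : ‖T - R‖ ≤ ‖S‖ :=
    CStarAlgebra.norm_le_norm_of_nonneg_of_le hdiff ((sub_le_self _ hR).trans hTS)
  calc ‖T x - R x‖ ^ 2 ≤ ‖T - R‖ * RCLike.re ⟪x, (T - R) x⟫_ℂ :=
        norm_apply_sq_le_of_nonneg hdiff x
    _ ≤ ‖S‖ * RCLike.re ⟪x, (T - R) x⟫_ℂ :=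
        mul_le_mul_of_nonneg_right hnorm (re_inner_nonneg hdiff x)
    _ = _ := by rw [sub_apply, inner_sub_right, map_sub]

variable {ι : Type*} [Preorder ι] [IsDirectedOrder ι] [Nonempty ι] {T : ι → E →L[ℂ] E}
  {S : E →L[ℂ] E}

theorem exists_tendsto_apply_of_monotone (hmono : Monotone T) (hnonneg : ∀ i, 0 ≤ T i)
    (hle : ∀ i, T i ≤ S) (x : E) : ∃ y, Tendsto (fun i => T i x) atTop (𝓝 y) := by
  let q (i : ι) : ℝ := RCLike.re ⟪x, T i x⟫_ℂ
  have hq : Monotone q := fun i j hij => re_inner_le_of_le (hmono hij) x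
  have hbdd : BddAbove (Set.range q) :=
    ⟨RCLike.re ⟪x, S x⟫_ℂ, Set.forall_mem_range.mpr fun i => re_inner_le_of_le (hle i) x⟩
  apply CompleteSpace.complete
  rw [Metric.cauchy_iff]
  refine ⟨inferInstance, fun ε hε => ?_⟩
  have hη : 0 < (ε / 2) ^ 2 / (‖S‖ + 1) := by positivity
  obtain ⟨N, hN⟩ := exists_lt_of_lt_ciSup (sub_lt_self (⨆ i, q i) hη)
  have hclose (i : ι) (hi : N ≤ i) : dist (T i x) (T N x) < ε / 2 := by
    rw [dist_eq_norm]
    refine lt_of_pow_lt_pow_left₀ 2 (by positivity)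
      ((norm_sub_apply_sq_le (hnonneg N) (hmono hi) (hle i) x).trans_lt ?_)
    have hsmall : q i - q N < (ε / 2) ^ 2 / (‖S‖ + 1) := by linarith [le_ciSup hbdd i]
    rw [lt_div_iff₀ (by positivity)] at hsmall
    nlinarith [sub_nonneg.mpr (hq hi)]
  refine ⟨(fun i => T i x) '' Set.Ici N, image_mem_map (Ici_mem_atTop N), ?_⟩
  rintro _ ⟨i, hi, rfl⟩ _ ⟨j, hj, rfl⟩
  calc dist (T i x) (T j x) ≤ dist (T i x) (T N x) + dist (T j x) (T N x) :=
        dist_triangle_right _ _ _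
    _ < ε / 2 + ε / 2 := add_lt_add (hclose i hi) (hclose j hj)
    _ = ε := add_halves ε

theorem tendsto_apply_of_isLUB (hmono : Monotone T) (hnonneg : ∀ i, 0 ≤ T i)
    (hS : IsLUB (Set.range T) S) (x : E) : Tendsto (fun i => T i x) atTop (𝓝 (S x)) := by
  have hle (i : ι) : T i ≤ S := hS.1 ⟨i, rfl⟩
  choose f hf using exists_tendsto_apply_of_monotone hmono hnonneg hle
  let R : E →L[ℂ] E := ContinuousLinearMap.ofTendstoOfBoundedRange f T (tendsto_pi_nhds.mpr hf)
    (isBounded_iff_forall_norm_le.mpr ⟨‖S‖, Set.forall_mem_range.mpr fun i =>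
      CStarAlgebra.norm_le_norm_of_nonneg_of_le (hnonneg i) (hle i)⟩)
  have hR (x : E) : Tendsto (fun i => T i x) atTop (𝓝 (R x)) := hf x
  have hSR : S ≤ R := hS.2 <| Set.forall_mem_range.mpr fun i =>
    isPositive_of_tendsto (l := atTop) (T := fun j => T j - T i)
      (fun x => (hR x).sub_const (T i x)) (by
        filter_upwards [Ici_mem_atTop i] with j hij
        exact hmono hij)
  have hRS : R ≤ S := isPositive_of_tendsto (l := atTop) (T := fun i => S - T i)
    (fun x => (hR x).const_sub (S x)) (Eventually.of_forall hle)
  rw [le_antisymm hSR hRS]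
  exact hR x

end MonotoneConvergence

section OperatorTrace

variable {E : Type v} [NormedAddCommGroup E] [InnerProductSpace ℂ E]
variable {ι : Type*} (b : HilbertBasis ι ℂ E)

theorem ofReal_norm_sq_eq_tsum (x : E) :
    ENNReal.ofReal (‖x‖ ^ 2) = ∑' i, ENNReal.ofReal (‖⟪b i, x⟫_ℂ‖ ^ 2) := by
  have hsum := Complex.hasSum_re (b.hasSum_inner_mul_inner x x)
  have hterm (i : ι) : (⟪x, b i⟫_ℂ * ⟪b i, x⟫_ℂ).re = ‖⟪b i, x⟫_ℂ‖ ^ 2 := by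
    rw [← inner_conj_symm, ← Complex.normSq_eq_conj_mul_self, Complex.ofReal_re,
      Complex.normSq_eq_norm_sq]
  have hself : (⟪x, x⟫_ℂ).re = ‖x‖ ^ 2 := inner_self_eq_norm_sq (𝕜 := ℂ) x
  simp only [hterm, hself] at hsum
  rw [← hsum.tsum_eq, ENNReal.ofReal_tsum_of_nonneg (fun _ => by positivity) hsum.summable]

/-- The canonical trace `Tr` on the positive operators, computed in the orthonormal basis `b`; its
values at other operators are meaningless. -/
def opTrace (T : E →L[ℂ] E) : ℝ≥0∞ :=
  ∑' i, ENNReal.ofReal (RCLike.re ⟪b i, T (b i)⟫_ℂ)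

theorem opTrace_add {T T' : E →L[ℂ] E} (hT : 0 ≤ T) (hT' : 0 ≤ T') :
    opTrace b (T + T') = opTrace b T + opTrace b T' := by
  rw [opTrace, opTrace, opTrace, ← ENNReal.tsum_add]
  refine tsum_congr fun i => ?_
  rw [add_apply, inner_add_right, map_add,
    ENNReal.ofReal_add (re_inner_nonneg hT _) (re_inner_nonneg hT' _)]

theorem opTrace_smul (c : NNReal) (T : E →L[ℂ] E) :
    opTrace b (((c : ℝ) : ℂ) • T) = c * opTrace b T := by
  rw [opTrace, opTrace, ← ENNReal.tsum_mul_left]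
  refine tsum_congr fun i => ?_
  have hinner : RCLike.re ⟪b i, (((c : ℝ) : ℂ) • T) (b i)⟫_ℂ = c * RCLike.re ⟪b i, T (b i)⟫_ℂ := by
    rw [smul_apply, inner_smul_right]
    exact Complex.re_ofReal_mul _ _
  rw [hinner, ENNReal.ofReal_mul c.coe_nonneg, ENNReal.ofReal_coe_nnreal]

theorem opTrace_rankOne_self (x : E) :
    opTrace b (InnerProductSpace.rankOne ℂ x x) = ENNReal.ofReal (‖x‖ ^ 2) := by
  rw [ofReal_norm_sq_eq_tsum b]
  refine tsum_congr fun i => ?_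
  rw [InnerProductSpace.rankOne_apply, inner_smul_right, ← inner_conj_symm,
    ← Complex.normSq_eq_conj_mul_self, Complex.normSq_eq_norm_sq]
  congr 1

variable [CompleteSpace E]

theorem opTrace_star_mul_self (T : E →L[ℂ] E) :
    opTrace b (star T * T) = ∑' i, ∑' j, ENNReal.ofReal (‖⟪b j, T (b i)⟫_ℂ‖ ^ 2) := by
  refine tsum_congr fun i => ?_
  rw [← ofReal_norm_sq_eq_tsum, mul_apply_eq_comp, ContinuousLinearMap.star_eq_adjoint,
    ContinuousLinearMap.adjoint_inner_right, inner_self_eq_norm_sq]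

theorem opTrace_star_mul_self_comm (T : E →L[ℂ] E) :
    opTrace b (star T * T) = opTrace b (T * star T) := by
  have hstar := opTrace_star_mul_self b (star T)
  rw [star_star] at hstar
  rw [hstar, opTrace_star_mul_self, ENNReal.tsum_comm]
  refine tsum_congr fun i => tsum_congr fun j => ?_
  rw [ContinuousLinearMap.star_eq_adjoint, ContinuousLinearMap.adjoint_inner_right,
    norm_inner_symm]

theorem eq_zero_of_opTrace_eq_zero {T : E →L[ℂ] E} (hT : 0 ≤ T) (htrace : opTrace b T = 0) :
    T = 0 := by
  rw [opTrace, ENNReal.tsum_eq_zero] at htrace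
  have hbasis (i : ι) : T (b i) = 0 := by
    have hle := norm_apply_sq_le_of_nonneg hT (b i)
    rw [le_antisymm (ENNReal.ofReal_eq_zero.mp (htrace i)) (re_inner_nonneg hT _), mul_zero] at hle
    exact norm_eq_zero.mp (pow_eq_zero_iff two_ne_zero |>.mp (le_antisymm hle (by positivity)))
  ext x
  have hsum := (b.hasSum_repr x).mapL T
  simp only [map_smul, hbasis, smul_zero] at hsum
  simpa using hsum.unique hasSum_zero

theorem opTrace_eq_iSup_of_isLUB {κ : Type*} [Preorder κ] [IsDirectedOrder κ] [Nonempty κ]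
    {T : κ → E →L[ℂ] E} {S : E →L[ℂ] E} (hmono : Monotone T) (hnonneg : ∀ k, 0 ≤ T k)
    (hS : IsLUB (Set.range T) S) : opTrace b S = ⨆ k, opTrace b (T k) := by
  have hmono_inner (x : E) : Monotone fun k => ENNReal.ofReal (RCLike.re ⟪x, T k x⟫_ℂ) :=
    fun _ _ hkl => ENNReal.ofReal_le_ofReal (re_inner_le_of_le (hmono hkl) x)
  have hsup (x : E) : ENNReal.ofReal (RCLike.re ⟪x, S x⟫_ℂ) =
      ⨆ k, ENNReal.ofReal (RCLike.re ⟪x, T k x⟫_ℂ) := by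
    refine tendsto_nhds_unique (ENNReal.tendsto_ofReal ?_) (tendsto_atTop_iSup (hmono_inner x))
    exact (RCLike.continuous_re.tendsto _).comp
      (tendsto_const_nhds.inner (tendsto_apply_of_isLUB hmono hnonneg hS x))
  simp only [opTrace, hsup, ENNReal.tsum_eq_iSup_sum]
  rw [iSup_comm]
  exact iSup_congr fun s => ENNReal.finsetSum_iSup_of_monotone fun i => hmono_inner (b i)

theorem isFaithfulNormalTrace_opTrace (W : Set (E →L[ℂ] E)) :
    IsFaithfulNormalTrace W (opTrace b) where
  map_add _ _ _ _ hT hT' := opTrace_add b hT hT'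
  map_smul T _ _ c := opTrace_smul b c T
  tracial T _ := opTrace_star_mul_self_comm b T
  faithful _ _ hT htrace := eq_zero_of_opTrace_eq_zero b hT htrace
  normal D _ hne hnonneg hdir S _ hS := by
    have : Nonempty D := hne.to_subtype
    have : IsDirectedOrder D := ⟨hdir.directed_val⟩
    rw [iSup_subtype']
    exact opTrace_eq_iSup_of_isLUB b (fun _ _ h => h) (fun T => hnonneg T T.2)
      (by rwa [Subtype.range_coe])

end OperatorTrace

namespace ContainsCompacts

variable {G : Type u} [Group G] {E : Type v} [NormedAddCommGroup E] [InnerProductSpace ℂ E]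
  {π : UnitaryRep G E}

theorem rankOne_mem_cstar (hπ : ContainsCompacts π) (x y : E) :
    InnerProductSpace.rankOne ℂ x y ∈ cstar π := by
  refine hπ _ ?_
  rw [InnerProductSpace.rankOne_def']
  exact (isCompactOperator_of_locallyCompactSpace_rng
    (ContinuousLinearMap.toSpanSingleton ℂ x)).comp_clm (innerSL ℂ y)

theorem isIrreducible [CompleteSpace E] [Nontrivial E] (hπ : ContainsCompacts π) :
    π.IsIrreducible := by
  refine ⟨inferInstance, fun S hSc hS => or_iff_not_imp_left.mpr fun hbot => ?_⟩
  obtain ⟨x, hxS, hx⟩ := S.ne_bot_iff.mp hbot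
  refine (Submodule.eq_top_iff').mpr fun y => ?_
  have hmem := apply_mem_of_mem_cstarAlgebra hSc hS
    (mem_cstarAlgebra.mpr (hπ.rankOne_mem_cstar y x)) hxS
  rw [InnerProductSpace.rankOne_apply] at hmem
  exact (S.smul_mem_iff (inner_self_ne_zero.mpr hx)).mp hmem

theorem isFactorial [Nontrivial E] (hπ : ContainsCompacts π) : IsFactorial π := by
  obtain ⟨e, he⟩ := exists_norm_eq E zero_le_one
  refine ⟨inferInstance, fun T _ hT => ⟨⟪e, T e⟫_ℂ, ?_⟩⟩
  ext x
  have hcomm := hT (InnerProductSpace.rankOne ℂ x e)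
    (subset_closure ⟨_, hπ.rankOne_mem_cstar x e, rfl⟩)
  simpa [he] using congrArg (fun S : E →L[ℂ] E => S e) hcomm

theorem isTraceable [CompleteSpace E] [Nontrivial E] (hπ : ContainsCompacts π) : π.IsTraceable := by
  obtain ⟨e, he⟩ := exists_norm_eq E zero_le_one
  obtain ⟨_, b, -⟩ := exists_hilbertBasis ℂ E
  refine ⟨hπ.isFactorial, opTrace b, isFaithfulNormalTrace_opTrace b _,
    InnerProductSpace.rankOne ℂ e e, hπ.rankOne_mem_cstar e e, ?_, ?_, ?_⟩
  · exact (ContinuousLinearMap.nonneg_iff_isPositive _).mpr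
      (InnerProductSpace.isPositive_rankOne_self e)
  · rw [opTrace_rankOne_self, he]
    simp
  · rw [opTrace_rankOne_self]
    exact ENNReal.ofReal_lt_top

end ContainsCompacts

section Intertwiners

variable {G : Type u} [Group G]
variable {E : Type v} [NormedAddCommGroup E] [InnerProductSpace ℂ E]
variable {F : Type w} [NormedAddCommGroup F] [InnerProductSpace ℂ F]
variable {π : UnitaryRep G E} {ρ : UnitaryRep G F}

theorem exists_linearIsometry_eq_smul_of_norm_sq_eq {T : E →ₗ[ℂ] F} {κ : ℝ} (hκ : 0 < κ)
    (hT : ∀ x, ‖T x‖ ^ 2 = κ * ‖x‖ ^ 2) :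
    ∃ (V : E →ₗᵢ[ℂ] F) (c : ℂ), ∀ x, V x = c • T x := by
  refine ⟨⟨((√κ)⁻¹ : ℂ) • T, fun x => ?_⟩, ((√κ)⁻¹ : ℂ), fun _ => rfl⟩
  rw [← sq_eq_sq₀ (norm_nonneg _) (norm_nonneg _), LinearMap.smul_apply, norm_smul, mul_pow, hT,
    norm_inv, Complex.norm_real, Real.norm_eq_abs, inv_pow, sq_abs, Real.sq_sqrt hκ.le,
    inv_mul_cancel_left₀ hκ.ne']

theorem UnitarilyEquivalent.symm (h : π.UnitarilyEquivalent ρ) : ρ.UnitarilyEquivalent π := by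
  obtain ⟨U, hU⟩ := h
  refine ⟨U.symm, fun g x => ?_⟩
  rw [LinearIsometryEquiv.symm_apply_eq, hU, LinearIsometryEquiv.apply_symm_apply]

theorem IsIrreducible.unitarilyEquivalent_of_linearIsometry [CompleteSpace E] [Nontrivial E]
    (hρ : ρ.IsIrreducible) (V : E →ₗᵢ[ℂ] F) (hV : ∀ g x, V (π g x) = ρ g (V x)) :
    π.UnitarilyEquivalent ρ := by
  have hinv : ∀ g, ∀ y ∈ LinearMap.range V.toLinearMap, ρ g y ∈ LinearMap.range V.toLinearMap := by
    rintro g _ ⟨x, rfl⟩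
    exact ⟨π g x, hV g x⟩
  have hne : LinearMap.range V.toLinearMap ≠ ⊥ := fun hbot => by
    obtain ⟨x, hx⟩ := exists_ne (0 : E)
    have hVx : V x ∈ LinearMap.range V.toLinearMap := ⟨x, rfl⟩
    rw [hbot, Submodule.mem_bot, map_eq_zero_iff V V.injective] at hVx
    exact hx hVx
  have htop := (hρ.2 _ V.isometry.isClosedEmbedding.isClosed_range hinv).resolve_left hne
  exact ⟨LinearIsometryEquiv.ofSurjective V (LinearMap.range_eq_top.mp htop), hV⟩

theorem IsIrreducible.unitarilyEquivalent_of_intertwines [FiniteDimensional ℂ E]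
    [CompleteSpace F] (hπ : π.IsIrreducible) (hρ : ρ.IsIrreducible) {T : E →L[ℂ] F}
    (hT : Intertwines π ρ T) {x₀ : E} (hx₀ : T x₀ ≠ 0) : π.UnitarilyEquivalent ρ := by
  have := hπ.1
  have : CompleteSpace E := FiniteDimensional.complete ℂ E
  obtain ⟨c, hc⟩ := hπ.exists_eq_smul_of_commute (T.adjoint ∘L T : E →L[ℂ] E) fun g x => by
    simpa [hT g x] using hT.adjoint g (T x)
  have hnorm (x : E) : ‖T x‖ ^ 2 = c.re * ‖x‖ ^ 2 :=
    calc ‖T x‖ ^ 2 = RCLike.re ⟪x, T.adjoint (T x)⟫_ℂ := by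
          rw [ContinuousLinearMap.adjoint_inner_right, inner_self_eq_norm_sq]
      _ = (c * (‖x‖ ^ 2 : ℝ)).re := by
          rw [show T.adjoint (T x) = c • x from hc x, inner_smul_right, inner_self_eq_norm_sq_to_K]
          simp
      _ = c.re * ‖x‖ ^ 2 := Complex.re_mul_ofReal _ _
  have hc_pos : 0 < c.re := by
    refine pos_of_mul_pos_left ?_ (sq_nonneg ‖x₀‖)
    rw [← hnorm]
    positivity
  obtain ⟨V, d, hV⟩ :=
    exists_linearIsometry_eq_smul_of_norm_sq_eq (T := (T : E →ₗ[ℂ] F)) hc_pos hnorm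
  refine hρ.unitarilyEquivalent_of_linearIsometry V fun g x => ?_
  simp [hV, hT g x]

end Intertwiners

section WeakEquivalence

theorem exists_norm_eq_one_apply_eq_self {E : Type*} [NormedAddCommGroup E] [NormedSpace ℂ E]
    {P : E →L[ℂ] E} (hP : IsIdempotentElem P) (hne : P ≠ 0) : ∃ η, ‖η‖ = 1 ∧ P η = η := by
  obtain ⟨ζ, hζ⟩ := DFunLike.ne_iff.mp hne
  refine ⟨(‖P ζ‖⁻¹ : ℂ) • P ζ, norm_smul_inv_norm hζ, ?_⟩
  rw [map_smul, ← mul_apply_eq_comp, hP]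

variable {E : Type v} [NormedAddCommGroup E] [InnerProductSpace ℂ E] [CompleteSpace E]
variable {F : Type w} [NormedAddCommGroup F] [InnerProductSpace ℂ F] [CompleteSpace F]

theorem star_rankOne_mul_rankOne (x e : E) :
    star (InnerProductSpace.rankOne ℂ x e) * InnerProductSpace.rankOne ℂ x e =
      ((‖x‖ ^ 2 : ℝ) : ℂ) • InnerProductSpace.rankOne ℂ e e := by
  rw [ContinuousLinearMap.star_eq_adjoint, InnerProductSpace.adjoint_rankOne,
    ContinuousLinearMap.mul_def, InnerProductSpace.rankOne_comp_rankOne,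
    inner_self_eq_norm_sq_to_K]
  norm_cast

/-- `V x = Φ(x ⊗ e⋆) η`, where `e` is a unit vector and `η` is a unit vector in the range of the
projection `Φ(e ⊗ e⋆)`. -/
theorem exists_linearIsometry_intertwining_starAlgHom [Nontrivial E]
    {A : StarSubalgebra ℂ (E →L[ℂ] E)} (hA : ∀ x y : E, InnerProductSpace.rankOne ℂ x y ∈ A)
    {Φ : A →⋆ₐ[ℂ] (F →L[ℂ] F)} (hΦ : Function.Injective Φ) :
    ∃ V : E →ₗᵢ[ℂ] F, ∀ (T : A) (x : E), V ((T : E →L[ℂ] E) x) = Φ T (V x) := by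
  obtain ⟨e, he⟩ := exists_norm_eq E zero_le_one
  let r : E →ₗ[ℂ] A :=
    { toFun := fun x => ⟨InnerProductSpace.rankOne ℂ x e, hA x e⟩
      map_add' := fun x y => Subtype.ext (by simp)
      map_smul' := fun c x => Subtype.ext (by simp) }
  have hr_mul (T : A) (x : E) : T * r x = r ((T : E →L[ℂ] E) x) :=
    Subtype.ext (InnerProductSpace.comp_rankOne _ _ _)
  have hr_star (x : E) : star (r x) * r x = ((‖x‖ ^ 2 : ℝ) : ℂ) • r e :=
    Subtype.ext (star_rankOne_mul_rankOne x e)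
  have hidem : IsIdempotentElem (r e) := by
    rw [IsIdempotentElem, hr_mul]
    congr
    change InnerProductSpace.rankOne ℂ e e e = e
    simp [he]
  have hne : r e ≠ 0 := by
    intro h
    have hnorm : ‖InnerProductSpace.rankOne ℂ e e‖ = 0 :=
      (congrArg (fun T : A => ‖(T : E →L[ℂ] E)‖) h).trans norm_zero
    rw [InnerProductSpace.norm_rankOne, he, mul_one] at hnorm
    exact one_ne_zero hnorm
  obtain ⟨η, hη, hη_fixed⟩ :=
    exists_norm_eq_one_apply_eq_self (hidem.map Φ) ((map_ne_zero_iff Φ hΦ).mpr hne)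
  have hnorm (x : E) : ‖Φ (r x) η‖ = ‖x‖ := by
    rw [← sq_eq_sq₀ (norm_nonneg _) (norm_nonneg _), ← inner_self_eq_norm_sq (𝕜 := ℂ),
      ← ContinuousLinearMap.adjoint_inner_right, ← ContinuousLinearMap.star_eq_adjoint,
      ← mul_apply_eq_comp, ← map_star, ← map_mul, hr_star, map_smul, smul_apply, hη_fixed,
      inner_smul_right, inner_self_eq_norm_sq_to_K, hη]
    simp [-Complex.ofReal_pow]
  let V : E →ₗ[ℂ] F :=
    (ContinuousLinearMap.apply ℂ F η).toLinearMap ∘ₗ Φ.toAlgHom.toLinearMap ∘ₗ r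
  refine ⟨⟨V, hnorm⟩, fun T x => ?_⟩
  change Φ (r ((T : E →L[ℂ] E) x)) η = Φ T (Φ (r x) η)
  rw [← hr_mul, map_mul, mul_apply_eq_comp]

variable {G : Type u} [Group G] {ρ : UnitaryRep G E} {π : UnitaryRep G F}

/-- The C⋆-algebra generated by the pairs `(ρ(f), π(f))`. When `ρ` and `π` are weakly equivalent,
it is the graph of an isomorphism of `C*_ρ(G)` with `C*_π(G)`. -/
def cstarGraph (ρ : UnitaryRep G E) (π : UnitaryRep G F) :
    StarSubalgebra ℂ ((E →L[ℂ] E) × (F →L[ℂ] F)) :=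
  StarSubalgebra.topologicalClosure
    { toSubalgebra := ((groupAlgebraHom ρ).prod (groupAlgebraHom π)).range
      star_mem' := by
        rintro _ ⟨a, rfl⟩
        obtain ⟨b, hρ, hπ⟩ := exists_groupAlgebraHom_eq_star ρ π a
        exact ⟨b, Prod.ext hρ hπ⟩ }

theorem isClosed_cstarGraph : IsClosed (cstarGraph ρ π : Set ((E →L[ℂ] E) × (F →L[ℂ] F))) :=
  StarSubalgebra.isClosed_topologicalClosure _

theorem groupAlgebraHom_mem_cstarGraph (a : MonoidAlgebra ℂ G) :
    (groupAlgebraHom ρ a, groupAlgebraHom π a) ∈ cstarGraph ρ π :=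
  StarSubalgebra.le_topologicalClosure _ ⟨a, rfl⟩

theorem cstarGraph_subset {s : Set ((E →L[ℂ] E) × (F →L[ℂ] F))} (hs : IsClosed s)
    (h : ∀ a, (groupAlgebraHom ρ a, groupAlgebraHom π a) ∈ s) :
    (cstarGraph ρ π : Set ((E →L[ℂ] E) × (F →L[ℂ] F))) ⊆ s := by
  rw [cstarGraph, StarSubalgebra.topologicalClosure_coe]
  refine closure_minimal ?_ hs
  rintro _ ⟨a, rfl⟩
  exact h a

variable (ρ π) in
/-- The first projection of the graph, through which the graph is identified with `C*_ρ(G)` when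
`ρ` and `π` are weakly equivalent. -/
def cstarGraphFst : cstarGraph ρ π →⋆ₐ[ℂ] cstarAlgebra ρ :=
  ((StarAlgHom.fst ℂ (E →L[ℂ] E) (F →L[ℂ] F)).comp (cstarGraph ρ π).subtype).codRestrict _
    fun p => cstarGraph_subset ((isClosed_cstarAlgebra ρ).preimage continuous_fst)
      (groupAlgebraHom_mem_cstarAlgebra ρ) p.2

theorem WeaklyEquivalent.norm_snd_eq_norm_fst (h : π.WeaklyEquivalent ρ)
    {p : (E →L[ℂ] E) × (F →L[ℂ] F)} (hp : p ∈ cstarGraph ρ π) : ‖p.2‖ = ‖p.1‖ :=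
  cstarGraph_subset (s := {p | ‖p.2‖ = ‖p.1‖})
    (isClosed_eq continuous_snd.norm continuous_fst.norm)
    (fun a => le_antisymm (h.1 a) (h.2 a)) hp

theorem WeaklyEquivalent.isometry_cstarGraphFst (h : π.WeaklyEquivalent ρ) :
    Isometry (cstarGraphFst ρ π) :=
  AddMonoidHomClass.isometry_of_norm _ fun p => by
    change ‖p.1.1‖ = max ‖p.1.1‖ ‖p.1.2‖
    rw [h.norm_snd_eq_norm_fst p.2, max_self]

theorem WeaklyEquivalent.bijective_cstarGraphFst (h : π.WeaklyEquivalent ρ) :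
    Function.Bijective (cstarGraphFst ρ π) := by
  refine ⟨h.isometry_cstarGraphFst.injective, fun T => ?_⟩
  have : CompleteSpace (cstarGraph ρ π) := isClosed_cstarGraph.completeSpace_coe
  have hclosed : IsClosed (Set.range fun p => (cstarGraphFst ρ π p : E →L[ℂ] E)) :=
    (isometry_subtype_coe.comp h.isometry_cstarGraphFst).isClosedEmbedding.isClosed_range
  have hsub : cstar ρ ⊆ Set.range fun p => (cstarGraphFst ρ π p : E →L[ℂ] E) := by
    refine closure_minimal ?_ hclosed
    rintro _ ⟨a, rfl⟩
    exact ⟨⟨_, groupAlgebraHom_mem_cstarGraph a⟩, rfl⟩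
  obtain ⟨p, hp⟩ := hsub (mem_cstarAlgebra.mp T.2)
  exact ⟨p, Subtype.ext hp⟩

theorem WeaklyEquivalent.exists_starAlgHom (h : π.WeaklyEquivalent ρ) :
    ∃ Φ : cstarAlgebra ρ →⋆ₐ[ℂ] (F →L[ℂ] F), Function.Injective Φ ∧
      ∀ g, Φ ⟨toOperators ρ g, toOperators_mem_cstarAlgebra ρ g⟩ = toOperators π g := by
  let e := StarAlgEquiv.ofBijective (cstarGraphFst ρ π) h.bijective_cstarGraphFst
  let snd := (StarAlgHom.snd ℂ (E →L[ℂ] E) (F →L[ℂ] F)).comp (cstarGraph ρ π).subtype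
  have hsnd : Function.Injective snd := (injective_iff_map_eq_zero snd).mpr fun p hp => by
    have hfst : p.1.1 = 0 := by
      rw [← norm_eq_zero, ← h.norm_snd_eq_norm_fst p.2, norm_eq_zero]
      exact hp
    exact Subtype.ext (Prod.ext hfst hp)
  refine ⟨snd.comp (e.symm : cstarAlgebra ρ →⋆ₐ[ℂ] cstarGraph ρ π),
    hsnd.comp e.symm.injective, fun g => ?_⟩
  have hg : (toOperators ρ g, toOperators π g) ∈ cstarGraph ρ π := by
    simpa using groupAlgebraHom_mem_cstarGraph (ρ := ρ) (π := π) (MonoidAlgebra.single g 1)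
  have hfst : e ⟨_, hg⟩ = ⟨toOperators ρ g, toOperators_mem_cstarAlgebra ρ g⟩ := rfl
  rw [← hfst]
  exact congrArg snd (e.symm_apply_apply _)

theorem WeaklyEquivalent.exists_linearIsometry [Nontrivial E] (h : π.WeaklyEquivalent ρ)
    (hρ : ContainsCompacts ρ) : ∃ V : E →ₗᵢ[ℂ] F, ∀ g x, V (ρ g x) = π g (V x) := by
  obtain ⟨Φ, hΦ, hΦρ⟩ := h.exists_starAlgHom
  obtain ⟨V, hV⟩ := exists_linearIsometry_intertwining_starAlgHom
    (fun x y => mem_cstarAlgebra.mpr (hρ.rankOne_mem_cstar x y)) hΦ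
  refine ⟨V, fun g x => ?_⟩
  rw [← toOperators_apply π, ← hΦρ, ← hV, toOperators_apply]

end WeakEquivalence

section Commensurability

open scoped Pointwise

variable {G : Type u} [Group G]

theorem mem_conjSubgroup {L : Subgroup G} {g x : G} : x ∈ conjSubgroup L g ↔ g * x * g⁻¹ ∈ L :=
  Iff.rfl

theorem conjSubgroup_inv_of_mem {L : Subgroup G} {g : G} (hg : g ∈ L) : conjSubgroup L g⁻¹ = L := by
  ext x
  rw [mem_conjSubgroup, inv_inv, L.mul_mem_cancel_right hg, L.mul_mem_cancel_left (L.inv_mem hg)]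

theorem toConjAct_smul_eq (L : Subgroup G) (g : G) :
    ConjAct.toConjAct g • L = conjSubgroup L g⁻¹ := by
  ext x
  rw [Subgroup.mem_pointwise_smul_iff_inv_smul_mem, mem_conjSubgroup, ← ConjAct.toConjAct_inv,
    ConjAct.toConjAct_smul]

theorem stabilizer_coset (Γ L : Subgroup G) (g : G) :
    MulAction.stabilizer Γ (g : G ⧸ L) = (conjSubgroup L g⁻¹).subgroupOf Γ := by
  ext x
  rw [MulAction.mem_stabilizer_iff, Subgroup.mem_subgroupOf, mem_conjSubgroup, eq_comm]
  change (g : G ⧸ L) = ((x : G) * g : G) ↔ _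
  rw [QuotientGroup.eq, inv_inv, mul_assoc]

theorem relIndex_conjSubgroup_ne_zero_iff {Γ L : Subgroup G} {g : G} :
    (conjSubgroup L g⁻¹).relIndex Γ ≠ 0 ↔ (MulAction.orbit Γ (g : G ⧸ L)).Finite := by
  rw [Subgroup.relIndex, ← stabilizer_coset, MulAction.index_stabilizer]
  exact ⟨Set.finite_of_ncard_ne_zero,
    fun h => ((Set.ncard_pos h).mpr ⟨_, MulAction.mem_orbit_self _⟩).ne'⟩

theorem HasSpectralGap.infinite_orbit {X : Type v} [MulAction G X] (h : HasSpectralGap G X)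
    (x : X) : (MulAction.orbit G x).Infinite := by
  intro hfin
  let χ : X → ℂ := (MulAction.orbit G x).indicator fun _ => 1
  have hχ : Memℓp χ 2 := by
    refine (memℓp_gen_iff (by norm_num)).mpr
      (summable_of_hasFiniteSupport (hfin.subset fun y hy => ?_))
    by_contra hne
    simp [χ, Set.indicator_of_notMem hne] at hy
  have hinv (s : G) : permutation G X s ⟨χ, hχ⟩ = ⟨χ, hχ⟩ := by
    ext y
    refine Set.indicator_const_eq_indicator_const (?_ : s⁻¹ • y ∈ _ ↔ y ∈ _)
    rw [← MulAction.orbit_eq_iff, ← MulAction.orbit_eq_iff, MulAction.orbit_smul]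
  have hzero : χ x = 0 :=
    congrArg (fun η : lp (fun _ : X => ℂ) 2 => η x) (eq_zero_of_not_weaklyContained_trivial h hinv)
  simp [χ] at hzero

theorem HasSpectralGapProperty.isSelfCommensurating {H : Subgroup G}
    (hH : HasSpectralGapProperty H) : IsSelfCommensurating H := by
  refine le_antisymm (fun g hg => ?_) fun g hg => ?_
  · rw [Subgroup.Commensurable.commensurator_mem_iff, toConjAct_smul_eq] at hg
    have hfin := relIndex_conjSubgroup_ne_zero_iff.mp hg.1
    by_contra hgH
    have hq : (g : G ⧸ H) ∈ cosetsAwayFromBase H := fun h =>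
      hgH (by simpa using QuotientGroup.eq.mp (Eq.symm h : ((1 : G) : G ⧸ H) = g))
    refine HasSpectralGap.infinite_orbit hH ⟨_, hq⟩
      (Set.Finite.of_finite_image (f := Subtype.val) (hfin.subset ?_) Subtype.val_injective.injOn)
    rintro _ ⟨_, ⟨x, rfl⟩, rfl⟩
    exact ⟨x, rfl⟩
  · rw [Subgroup.Commensurable.commensurator_mem_iff, toConjAct_smul_eq,
      conjSubgroup_inv_of_mem hg]

theorem IsSelfCommensurating.conjSubgroup_inv {L : Subgroup G} (hL : IsSelfCommensurating L)
    (g : G) : IsSelfCommensurating (conjSubgroup L g⁻¹) := by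
  ext x
  rw [Subgroup.Commensurable.commensurator_mem_iff, ← toConjAct_smul_eq,
    Subgroup.Commensurable.commensurable_conj (ConjAct.toConjAct g)⁻¹, inv_smul_smul, ← mul_smul,
    ← mul_smul, ← ConjAct.toConjAct_inv, ← ConjAct.toConjAct_mul, ← ConjAct.toConjAct_mul,
    ← Subgroup.Commensurable.commensurator_mem_iff, hL, toConjAct_smul_eq, mem_conjSubgroup,
    inv_inv, mul_assoc]

theorem IsSelfCommensurating.eq_of_commensurable {H L : Subgroup G} (hH : IsSelfCommensurating H)
    (hL : IsSelfCommensurating L) (h : H.Commensurable L) : H = L := by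
  rw [← hH, h.eq, hL]

end Commensurability

section Rigidity

open InducedSpace

variable {G : Type u} [Group G] {H L Γ : Subgroup G}
variable {K : Type v} [NormedAddCommGroup K] [InnerProductSpace ℂ K]
variable {M : Type w} [NormedAddCommGroup M] [InnerProductSpace ℂ M]

theorem Intertwines.sliceNorm_mul_left {σ : UnitaryRep L K} {τ : UnitaryRep Γ M}
    {T : M →L[ℂ] InducedSpace σ} (hT : Intertwines τ ((induced σ).comp Γ.subtype) T)
    (x : Γ) (y : G) : sliceNorm T (x * y) = sliceNorm T y := by
  have hcomp : evalCLM σ (x * y) ∘L T =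
      (evalCLM σ y ∘L T) ∘L ((τ x⁻¹).toContinuousLinearEquiv : M →L[ℂ] M) := by
    ext1 m
    change T m (x * y) = T (τ x⁻¹ m) y
    rw [hT]
    change _ = T m ((x⁻¹ : Γ)⁻¹ * y)
    simp
  rw [sliceNorm, hcomp]
  exact ContinuousLinearMap.opNorm_comp_linearIsometryEquiv _ _

/-- The slice norms of `T` are constant on `Γ`-orbits in `G/L` and square summable. -/
theorem Intertwines.relIndex_conjSubgroup_ne_zero [FiniteDimensional ℂ M] {σ : UnitaryRep L K}
    {τ : UnitaryRep Γ M} {T : M →L[ℂ] InducedSpace σ}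
    (hT : Intertwines τ ((induced σ).comp Γ.subtype) T) {g : G} (hg : evalCLM σ g ∘L T ≠ 0) :
    (conjSubgroup L g⁻¹).relIndex Γ ≠ 0 := by
  rw [relIndex_conjSubgroup_ne_zero_iff]
  have hpos : 0 < sliceNorm T g ^ 2 := pow_pos (norm_pos_iff.mpr hg) 2
  have hsuper : {q : G ⧸ L | ¬ sliceNorm T q.out ^ 2 < sliceNorm T g ^ 2}.Finite :=
    (summable_sliceNorm_sq T).tendsto_cofinite_zero.eventually_lt_const hpos
  refine hsuper.subset ?_
  rintro _ ⟨x, rfl⟩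
  have hslice : sliceNorm T (x • (g : G ⧸ L)).out = sliceNorm T g := by
    rw [← hT.sliceNorm_mul_left x g]
    refine sliceNorm_congr T ?_
    rw [QuotientGroup.out_eq']
    rfl
  exact (congrArg (· ^ 2) hslice).not_lt

theorem intertwines_evalCLM (σ : UnitaryRep L M) (g : G) :
    Intertwines ((induced σ).comp (conjSubgroup L g⁻¹).subtype) (conjRep σ g⁻¹) (evalCLM σ g) := by
  intro x f
  let l : L := ⟨g⁻¹ * x * g⁻¹⁻¹, x.2⟩
  have hl : (x : G)⁻¹ * g = g * (l⁻¹ : L) := by simp [l, mul_assoc]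
  change f ((x : G)⁻¹ * g) = σ l (f g)
  rw [hl, f.apply_mul, inv_inv]

theorem adjoint_evalCLM_one [CompleteSpace K] (π : UnitaryRep H K) :
    (evalCLM π 1).adjoint = inclCLM π := by
  rw [eq_comm, ContinuousLinearMap.eq_adjoint_iff]
  exact inner_inclCLM_left

theorem IsIrreducible.conjRep_comp_inclusion {σ : UnitaryRep L M} (hσ : σ.IsIrreducible) {g : G}
    (hg : H = conjSubgroup L g) :
    IsIrreducible ((conjRep σ g).comp (Subgroup.inclusion hg.le) : UnitaryRep H M) := by
  refine ⟨hσ.1, fun S hS hinv => hσ.2 S hS fun l m hm => ?_⟩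
  have hx : g⁻¹ * l * g ∈ H := by
    rw [hg, mem_conjSubgroup]
    simp [mul_assoc]
  have hl : ((conjRep σ g).comp (Subgroup.inclusion hg.le) : UnitaryRep H M) ⟨_, hx⟩ = σ l := by
    refine congrArg σ (Subtype.ext ?_)
    change g * (g⁻¹ * l * g) * g⁻¹ = l
    simp [mul_assoc]
  exact hl ▸ hinv ⟨_, hx⟩ m hm

theorem exists_evalCLM_comp_ne_zero [CompleteSpace K] {π : UnitaryRep H K} {σ : UnitaryRep L M}
    {W : InducedSpace π →L[ℂ] InducedSpace σ} (hW : Intertwines (induced π) (induced σ) W)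
    (hne : W ≠ 0) : ∃ g, evalCLM σ g ∘L W ∘L inclCLM π ≠ 0 := by
  by_contra! h
  have hker : W.ker = ⊤ := eq_top_of_induced_inclCLM_mem W.isClosed_ker fun g k => by
    have hk : W (inclCLM π k) = 0 := InducedSpace.ext fun x => DFunLike.congr_fun (h x) k
    rw [LinearMap.mem_ker, ContinuousLinearMap.coe_coe, hW, hk, map_zero]
  exact hne (ContinuousLinearMap.coe_injective (LinearMap.ker_eq_top.mp hker))

variable [FiniteDimensional ℂ K] [FiniteDimensional ℂ M]

theorem commensurable_of_intertwines {π : UnitaryRep H K} {σ : UnitaryRep L M}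
    {W : InducedSpace π →L[ℂ] InducedSpace σ} (hW : Intertwines (induced π) (induced σ) W) {g : G}
    (hg : evalCLM σ g ∘L W ∘L inclCLM π ≠ 0) : H.Commensurable (conjSubgroup L g⁻¹) := by
  have : CompleteSpace K := FiniteDimensional.complete ℂ K
  have : CompleteSpace M := FiniteDimensional.complete ℂ M
  have hincl : Intertwines π ((induced σ).comp H.subtype) (W ∘L inclCLM π) := fun h k =>
    (congrArg W (intertwines_inclCLM h k)).trans (hW h _)
  have heval : Intertwines ((induced π).comp (conjSubgroup L g⁻¹).subtype) (conjRep σ g⁻¹)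
      (evalCLM σ g ∘L W) := fun x f =>
    (congrArg (evalCLM σ g) (hW x f)).trans (intertwines_evalCLM σ g x (W f))
  have hadj : evalCLM π 1 ∘L (evalCLM σ g ∘L W).adjoint ≠ 0 := by
    intro h
    refine hg (ContinuousLinearMap.adjoint.injective ?_)
    rw [map_zero, ← ContinuousLinearMap.comp_assoc, ContinuousLinearMap.adjoint_comp,
      ← adjoint_evalCLM_one, ContinuousLinearMap.adjoint_adjoint, h]
  have hindex := heval.adjoint.relIndex_conjSubgroup_ne_zero hadj
  rw [conjSubgroup_inv_of_mem H.one_mem] at hindex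
  exact ⟨hindex, hincl.relIndex_conjSubgroup_ne_zero hg⟩

theorem exists_conj_of_intertwines (hH : IsSelfCommensurating H) (hL : IsSelfCommensurating L)
    {π : UnitaryRep H K} {σ : UnitaryRep L M} (hπ : π.IsIrreducible) (hσ : σ.IsIrreducible)
    {W : InducedSpace π →L[ℂ] InducedSpace σ} (hW : Intertwines (induced π) (induced σ) W)
    (hne : W ≠ 0) :
    ∃ (g : G) (hg : H = conjSubgroup L g),
      π.UnitarilyEquivalent ((conjRep σ g).comp (Subgroup.inclusion hg.le)) := by
  have : CompleteSpace K := FiniteDimensional.complete ℂ K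
  have : CompleteSpace M := FiniteDimensional.complete ℂ M
  obtain ⟨g, hg⟩ := exists_evalCLM_comp_ne_zero hW hne
  have hHL : H = conjSubgroup L g⁻¹ :=
    hH.eq_of_commensurable (hL.conjSubgroup_inv g) (commensurable_of_intertwines hW hg)
  have hT : Intertwines π ((conjRep σ g⁻¹).comp (Subgroup.inclusion hHL.le))
      (evalCLM σ g ∘L W ∘L inclCLM π) := fun h k =>
    calc evalCLM σ g (W (inclCLM π (π h k)))
        = evalCLM σ g (induced σ h (W (inclCLM π k))) := by
          rw [← hW]
          exact congrArg (evalCLM σ g ∘L W) (intertwines_inclCLM h k)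
      _ = _ := intertwines_evalCLM σ g (Subgroup.inclusion hHL.le h) (W (inclCLM π k))
  obtain ⟨k, hk⟩ := DFunLike.ne_iff.mp hg
  exact ⟨g⁻¹, hHL, hπ.unitarilyEquivalent_of_intertwines (hσ.conjRep_comp_inclusion hHL) hT hk⟩

end Rigidity

end UnitaryRep

theorem mainTheorem1_general {G : Type u} [Group G] (H : Subgroup G)
    (hH : UnitaryRep.HasSpectralGapProperty H) :
    (∀ (K : Type v) [NormedAddCommGroup K] [InnerProductSpace ℂ K] [CompleteSpace K]
        [FiniteDimensional ℂ K] (σ : UnitaryRep H K), σ.IsIrreducible →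
        (UnitaryRep.induced σ).IsIrreducible ∧ (UnitaryRep.induced σ).IsTraceable ∧
          (UnitaryRep.induced σ).ContainsCompacts) ∧
    (∀ (K : Type v) [NormedAddCommGroup K] [InnerProductSpace ℂ K] [FiniteDimensional ℂ K]
        (σ : UnitaryRep H K)
        (E : Type w) [NormedAddCommGroup E] [InnerProductSpace ℂ E] [CompleteSpace E]
        (π : UnitaryRep G E), σ.IsIrreducible → π.IsIrreducible →
        π.WeaklyEquivalent (UnitaryRep.induced σ) →
        π.UnitarilyEquivalent (UnitaryRep.induced σ)) ∧
    (∀ (L : Subgroup G), UnitaryRep.IsSelfCommensurating L →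
      ∀ (K : Type v) [NormedAddCommGroup K] [InnerProductSpace ℂ K] [FiniteDimensional ℂ K]
        (π : UnitaryRep H K)
        (M : Type w) [NormedAddCommGroup M] [InnerProductSpace ℂ M] [FiniteDimensional ℂ M]
        (σ : UnitaryRep L M), π.IsIrreducible → σ.IsIrreducible →
        (UnitaryRep.induced σ).WeaklyEquivalent (UnitaryRep.induced π) →
        ∃ (g : G) (hg : H = UnitaryRep.conjSubgroup L g),
          π.UnitarilyEquivalent ((UnitaryRep.conjRep σ g).comp (Subgroup.inclusion hg.le))) := by
  refine ⟨fun K _ _ _ _ σ hσ => ?_, fun K _ _ _ σ E _ _ _ π hσ hπ hw => ?_,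
    fun L hL K _ _ _ π M _ _ _ σ hπ hσ hw => ?_⟩
  · have := hσ.1
    have hcompact := hH.containsCompacts_induced hσ
    exact ⟨hcompact.isIrreducible, hcompact.isTraceable, hcompact⟩
  · have := hσ.1
    have : CompleteSpace K := FiniteDimensional.complete ℂ K
    obtain ⟨V, hV⟩ := hw.exists_linearIsometry (hH.containsCompacts_induced hσ)
    exact (hπ.unitarilyEquivalent_of_linearIsometry V hV).symm
  · have := hπ.1
    have : CompleteSpace K := FiniteDimensional.complete ℂ K
    have : CompleteSpace M := FiniteDimensional.complete ℂ M
    obtain ⟨V, hV⟩ := hw.exists_linearIsometry (hH.containsCompacts_induced hπ)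
    have hne : V.toContinuousLinearMap ≠ 0 := fun h => by
      obtain ⟨f, hf⟩ := exists_ne (0 : UnitaryRep.InducedSpace π)
      exact hf ((map_eq_zero_iff V V.injective).mp (DFunLike.congr_fun h f))
    exact UnitaryRep.exists_conj_of_intertwines (W := V.toContinuousLinearMap)
      hH.isSelfCommensurating hL hπ hσ hV hne

theorem mainTheorem1 {G : Type u} [Group G] [Countable G] (H : Subgroup G)
    (hH : UnitaryRep.HasSpectralGapProperty H) :
    (∀ (K : Type v) [NormedAddCommGroup K] [InnerProductSpace ℂ K] [CompleteSpace K]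
        [FiniteDimensional ℂ K] (σ : UnitaryRep H K), σ.IsIrreducible →
        (UnitaryRep.induced σ).IsIrreducible ∧ (UnitaryRep.induced σ).IsTraceable ∧
          (UnitaryRep.induced σ).ContainsCompacts) ∧
    (∀ (K : Type v) [NormedAddCommGroup K] [InnerProductSpace ℂ K] [CompleteSpace K]
        [FiniteDimensional ℂ K] (σ : UnitaryRep H K)
        (E : Type w) [NormedAddCommGroup E] [InnerProductSpace ℂ E] [CompleteSpace E]
        (π : UnitaryRep G E), σ.IsIrreducible → π.IsIrreducible →
        π.WeaklyEquivalent (UnitaryRep.induced σ) →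
        π.UnitarilyEquivalent (UnitaryRep.induced σ)) ∧
    (∀ (L : Subgroup G), UnitaryRep.IsSelfCommensurating L →
      ∀ (K : Type v) [NormedAddCommGroup K] [InnerProductSpace ℂ K] [CompleteSpace K]
        [FiniteDimensional ℂ K] (π : UnitaryRep H K)
        (M : Type w) [NormedAddCommGroup M] [InnerProductSpace ℂ M] [CompleteSpace M]
        [FiniteDimensional ℂ M] (σ : UnitaryRep L M), π.IsIrreducible → σ.IsIrreducible →
        (UnitaryRep.induced σ).WeaklyEquivalent (UnitaryRep.induced π) →
        ∃ (g : G) (hg : H = UnitaryRep.conjSubgroup L g),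
          π.UnitarilyEquivalent ((UnitaryRep.conjRep σ g).comp (Subgroup.inclusion hg.le))) := by
  have h := mainTheorem1_general.{u, v, w} H hH
  exact ⟨h.1, fun K _ _ _ _ => h.2.1 K, fun L hL K _ _ _ _ π M _ _ _ _ => h.2.2 L hL K π M⟩

end
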